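/- Let $g:\mathbb R\to\mathbb R$ be $\mathcal C^2$ and $1$-periodic, let $\lambda>0$, and for $\epsilon>0$ put $\Gamma_\epsilon=\{x\in\mathbb R^2: x_1=\epsilon g(x_2/\epsilon)\}$. Put $\Gamma=\{z_1=0\}$, $\Omega^L=\{z_1<0\}$, $\Omega^R=\{z_1>0\}$. Let $A$ be a metric space and, for $i=L,R$, let $A^i\subset A$ be nonempty and compact, with $A^L\cap A^R=\emptyset$. Let $f^i:\mathbb R^2\times A^i\to\mathbb R^2$ and $\ell^i:\mathbb R^2\times A^i\to\mathbb R$ be continuous and bounded, with $f^i(\cdot,a)$ Lipschitz continuous uniformly in $a\in A^i$, and $\ell^i(\cdot,a)$ having a modulus of continuity independent of $a\in A^i$. Assume that $\{(f^i(x,a),\ell^i(x,a)):a\in A^i\}$ is closed and convex for every $x\in\mathbb R^2$, and that there are $\delta_0>0$ and $\epsilon_0>0$ such that $B(0,\delta_0)\subset\{f^i(x,a):a\in A^i\}$ for $i=L,R$, all $\epsilon\in(0,\epsilon_0)$ and all $x\in\Gamma_\epsilon$. For $z\in\mathbb R^2$ let $G_\epsilon^{-1}(z)=(z_1+\epsilon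 g(z_2/\epsilon),z_2)$, $J_\epsilon(z)=\begin{pmatrix}1&-g'(z_2/\epsilon)\\0&1\end{pmatrix}$, and set $\tilde f^i_\epsilon(z,a)=J_\epsilon(z)f^i(G_\epsilon^{-1}(z),a)$, $\tilde\ell^i_\epsilon(z,a)=\ell^i(G_\epsilon^{-1}(z),a)$. Let $\mathcal M$ be the set of pairs $(z,a)$ with $a\in A^i$ if $z\in\Omega^i$, and $a\in A^L\cup A^R$ if $z\in\Gamma$. On $\mathcal M$ let $\tilde f_\epsilon(z,a)=\tilde f^i_\epsilon(z,a)$ and $\tilde\ell_\epsilon(z,a)=\tilde\ell^i_\epsilon(z,a)$ if $z\in\Omega^i$, or if $z\in\Gamma$ and $a\in A^i$. Let $\widetilde{\mathcal T}_{z,\epsilon}$ be the set of pairs $(y,a)$ with $a$ measurable on $[0,\infty)$, $y:[0,\infty)\to\mathbb R^2$ Lipschitz continuous, $(y(t),a(t))\in\mathcal M$ for a.e. $t\ge0$, and $y(t)=z+\int_0^t\tilde f_\epsilon(y(s),a(s))\,ds$ for all $t\ge 0$. Define $$\tilde v_\epsilon(z)=\inf_{(y,a)\in\widetilde{\mathcal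 T}_{z,\epsilon}}\int_0^\infty\tilde\ell_\epsilon(y(t),a(t))e^{-\lambda t}\,dt,\qquad H^i(z,p)=\max_{a\in A^i}\bigl(-p\cdot f^i(z,a)-\ell^i(z,a)\bigr),$$ $$\overline{\tilde v}(z)=\limsup_{z'\to z,\ \epsilon\to0^+}\tilde v_\epsilon(z'),\qquad \underline{\tilde v}(z)=\liminf_{z'\to z,\ \epsilon\to0^+}\tilde v_\epsilon(z').$$ Then, for all sufficiently small $\epsilon>0$, the sets $\widetilde{\mathcal T}_{z,\epsilon}$ are nonempty for every $z$, and the functions $\tilde v_\epsilon$ are bounded on $\mathbb R^2$ uniformly in such $\epsilon$. The functions $\overline{\tilde v}$ and $\underline{\tilde v}$ are bounded on $\mathbb R^2$, and for $i=L,R$ they are respectively a viscosity subsolution and a viscosity supersolution in $\Omega^i$ of $$\lambda u(z)+H^i(z,Du(z))=0 .$$ That is, $\overline{\tilde v}$ is upper semicontinuous in $\Omega^i$, and $\lambda\overline{\tilde v}(z)+H^i(z,D\varphi(z))\le0$ whenever $z\in\Omega^i$, $\varphi\in\mathcal C^1(\Omega^i)$ and $\overline{\tilde v}-\varphi$ has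 a local maximum at $z$. Similarly, $\underline{\tilde v}$ is lower semicontinuous in $\Omega^i$, and $\lambda\underline{\tilde v}(z)+H^i(z,D\varphi(z))\ge0$ whenever $z\in\Omega^i$, $\varphi\in\mathcal C^1(\Omega^i)$ and $\underline{\tilde v}-\varphi$ has a local minimum at $z$. -/

import Mathlib

open Set Filter Topology MeasureTheory
open scoped NNReal Matrix

namespace OscillatingInterface

/-- The Euclidean plane; `z 0` and `z 1` are the coordinates `z₁` and `z₂`. -/
abbrev Plane : Type := EuclideanSpace ℝ (Fin 2)

/-- The two sides of the interface. -/
inductive Side : Type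
  | L
  | R

/-- The open half-planes `Ω^L = {z₁ < 0}` and `Ω^R = {z₁ > 0}`. -/
def halfPlane : Side → Set Plane
  | Side.L => {z | z 0 < 0}
  | Side.R => {z | 0 < z 0}

/-- The straight interface `Γ = {z₁ = 0}`. -/
def straightInterface : Set Plane := {z | z 0 = 0}

/-- The data of the control problem: the interface profile `g`, the control sets `A^i`,
the dynamics `f^i`, the running costs `ℓ^i` and the discount rate `λ`. The functions `f i x a`
and `ℓ i x a` are only ever used for `a ∈ ctrl i`. -/
structure ControlProblem (A : Type*) where
  g : ℝ → ℝ
  ctrl : Side → Set A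
  f : Side → Plane → A → Plane
  cost : Side → Plane → A → ℝ
  discount : ℝ

namespace ControlProblem

variable {A : Type*}

/-- The oscillating interface `Γ_ε = {x₁ = ε g(x₂/ε)}`. -/
def oscInterface (P : ControlProblem A) (ε : ℝ) : Set Plane :=
  {x | x 0 = ε * P.g (x 1 / ε)}

/-- The standing assumptions on the data. -/
structure StandingAssumptions [MetricSpace A] (P : ControlProblem A) : Prop where
  discount_pos : 0 < P.discount
  g_contDiff : ContDiff ℝ 2 P.g
  g_periodic : Function.Periodic P.g 1
  ctrl_nonempty : ∀ i, (P.ctrl i).Nonempty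
  ctrl_compact : ∀ i, IsCompact (P.ctrl i)
  ctrl_disjoint : Disjoint (P.ctrl Side.L) (P.ctrl Side.R)
  f_continuous : ∀ i, ContinuousOn (fun q : Plane × A => P.f i q.1 q.2) (univ ×ˢ P.ctrl i)
  f_bounded : ∃ M : ℝ, ∀ i x, ∀ a ∈ P.ctrl i, ‖P.f i x a‖ ≤ M
  f_lipschitz : ∃ Lf : ℝ, 0 < Lf ∧
    ∀ i x y, ∀ a ∈ P.ctrl i, ‖P.f i x a - P.f i y a‖ ≤ Lf * ‖x - y‖
  cost_continuous : ∀ i,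
    ContinuousOn (fun q : Plane × A => P.cost i q.1 q.2) (univ ×ˢ P.ctrl i)
  cost_bounded : ∃ M : ℝ, ∀ i x, ∀ a ∈ P.ctrl i, |P.cost i x a| ≤ M
  cost_modulus : ∃ ω : ℝ → ℝ, ω 0 = 0 ∧ ContinuousWithinAt ω (Ici 0) 0 ∧
    ∀ i x y, ∀ a ∈ P.ctrl i, |P.cost i x a - P.cost i y a| ≤ ω ‖x - y‖
  closed_convex : ∀ i x,
    IsClosed ((fun a => (P.f i x a, P.cost i x a)) '' P.ctrl i) ∧
    Convex ℝ ((fun a => (P.f i x a, P.cost i x a)) '' P.ctrl i)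
  controllable : ∃ δ₀ : ℝ, 0 < δ₀ ∧ ∃ ε₀ : ℝ, 0 < ε₀ ∧ ∀ ε : ℝ, 0 < ε → ε < ε₀ →
    ∀ i, ∀ x ∈ P.oscInterface ε, Metric.ball (0 : Plane) δ₀ ⊆ P.f i x '' P.ctrl i

/-- The Hamiltonian `H^i(x,p) = max_{a ∈ A^i} (-p · f^i(x,a) - ℓ^i(x,a))`. -/
noncomputable def hamiltonian (P : ControlProblem A) (i : Side) (x p : Plane) : ℝ :=
  sSup ((fun a => -inner ℝ p (P.f i x a) - P.cost i x a) '' P.ctrl i)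

/-- `G⁻¹(z) = (z₁ + ε g(z₂/ε), z₂)`, which maps `Γ` onto `Γ_ε`. -/
noncomputable def unstraighten (P : ControlProblem A) (ε : ℝ) (z : Plane) : Plane :=
  !₂[z 0 + ε * P.g (z 1 / ε), z 1]

/-- The Jacobian matrix `J_ε(z)` of `G(x) = (x₁ - ε g(x₂/ε), x₂)`. -/
noncomputable def jacobian (P : ControlProblem A) (ε : ℝ) (z : Plane) :
    Matrix (Fin 2) (Fin 2) ℝ :=
  !![1, -deriv P.g (z 1 / ε); 0, 1]

/-- The dynamics `J_ε(z) f^i(G⁻¹(z), a)` of side `i` in the straightened geometry. -/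
noncomputable def sideDynamics (P : ControlProblem A) (ε : ℝ) (i : Side) (z : Plane) (a : A) :
    Plane :=
  WithLp.toLp 2 (P.jacobian ε z *ᵥ (P.f i (P.unstraighten ε z) a).ofLp)

/-- The running cost `ℓ^i(G⁻¹(z), a)` of side `i` in the straightened geometry. -/
noncomputable def sideCost (P : ControlProblem A) (ε : ℝ) (i : Side) (z : Plane) (a : A) : ℝ :=
  P.cost i (P.unstraighten ε z) a

/-- The admissible state-control pairs: `a ∈ A^i` if `z ∈ Ω^i`, and `a ∈ A^L ∪ A^R` if `z ∈ Γ`. -/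
def admissiblePairs (P : ControlProblem A) : Set (Plane × A) :=
  {q | (∀ i, q.1 ∈ halfPlane i → q.2 ∈ P.ctrl i) ∧
    (q.1 ∈ straightInterface → q.2 ∈ P.ctrl Side.L ∪ P.ctrl Side.R)}

open Classical in
/-- The side whose dynamics and cost are in force at an admissible pair `(z, a)`: `i` if `z ∈ Ω^i`,
and on `Γ` the side `i` with `a ∈ A^i`. -/
noncomputable def activeSide (P : ControlProblem A) (z : Plane) (a : A) : Side :=
  if z ∈ halfPlane Side.L then Side.L
  else if z ∈ halfPlane Side.R then Side.R
  else if a ∈ P.ctrl Side.L then Side.L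
  else Side.R

/-- The dynamics in the straightened geometry on admissible pairs. -/
noncomputable def dynamics (P : ControlProblem A) (ε : ℝ) (z : Plane) (a : A) : Plane :=
  P.sideDynamics ε (P.activeSide z a) z a

/-- The running cost in the straightened geometry on admissible pairs. -/
noncomputable def runningCost (P : ControlProblem A) (ε : ℝ) (z : Plane) (a : A) : ℝ :=
  P.sideCost ε (P.activeSide z a) z a

/-- The admissible trajectories `(y, a)` starting from `z`: `a` is measurable on `[0,∞)`,
`(y(t), a(t))` is an admissible pair for almost every `t ≥ 0` (so that it is locally bounded),
`y` is Lipschitz continuous on `[0,∞)` and solves the state equation in integral form. -/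
def trajectories [MetricSpace A] (P : ControlProblem A) (ε : ℝ) (z : Plane) :
    Set ((ℝ → Plane) × (ℝ → A)) :=
  {q | AEStronglyMeasurable q.2 (volume.restrict (Ici 0)) ∧
    (∀ᵐ t ∂(volume.restrict (Ici (0 : ℝ))), (q.1 t, q.2 t) ∈ P.admissiblePairs) ∧
    (∃ K : ℝ≥0, LipschitzOnWith K q.1 (Ici 0)) ∧
    ∀ t : ℝ, 0 ≤ t → q.1 t = z + ∫ s in (0 : ℝ)..t, P.dynamics ε (q.1 s) (q.2 s)}

/-- The discounted cost of a trajectory. -/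
noncomputable def totalCost (P : ControlProblem A) (ε : ℝ) (q : (ℝ → Plane) × (ℝ → A)) : ℝ :=
  ∫ t in Ioi (0 : ℝ), P.runningCost ε (q.1 t) (q.2 t) * Real.exp (-P.discount * t)

/-- The value function of the straightened control problem. -/
noncomputable def value [MetricSpace A] (P : ControlProblem A) (ε : ℝ) (z : Plane) : ℝ :=
  sInf (P.totalCost ε '' P.trajectories ε z)

/-- The relaxed upper semilimit, `limsup` of the value function as `ε → 0⁺` and `z' → z`. -/
noncomputable def upperSemilimit [MetricSpace A] (P : ControlProblem A) (z : Plane) : ℝ :=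
  limsup (fun q : ℝ × Plane => P.value q.1 q.2) (𝓝[>] (0 : ℝ) ×ˢ 𝓝 z)

/-- The relaxed lower semilimit, `liminf` of the value function as `ε → 0⁺` and `z' → z`. -/
noncomputable def lowerSemilimit [MetricSpace A] (P : ControlProblem A) (z : Plane) : ℝ :=
  liminf (fun q : ℝ × Plane => P.value q.1 q.2) (𝓝[>] (0 : ℝ) ×ˢ 𝓝 z)

end ControlProblem

/-- `u` is a viscosity subsolution of `lam * u + H(z, Du) = 0` in the open set `U`. -/
def IsViscositySubsolution (lam : ℝ) (H : Plane → Plane → ℝ) (U : Set Plane) (u : Plane → ℝ) :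
    Prop :=
  UpperSemicontinuousOn u U ∧
  ∀ φ : Plane → ℝ, ContDiffOn ℝ 1 φ U → ∀ z ∈ U, IsLocalMax (fun y => u y - φ y) z →
    lam * u z + H z (gradient φ z) ≤ 0

/-- `u` is a viscosity supersolution of `lam * u + H(z, Du) = 0` in the open set `U`. -/
def IsViscositySupersolution (lam : ℝ) (H : Plane → Plane → ℝ) (U : Set Plane) (u : Plane → ℝ) :
    Prop :=
  LowerSemicontinuousOn u U ∧
  ∀ φ : Plane → ℝ, ContDiffOn ℝ 1 φ U → ∀ z ∈ U, IsLocalMin (fun y => u y - φ y) z →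
    0 ≤ lam * u z + H z (gradient φ z)

end OscillatingInterface

/-! Near a point of `Ω^i` only side `i` acts, because speeds are bounded uniformly in `ε`. The
difficulty is that the straightened dynamics `J_ε f^i` need not converge: the term in `g'(z₂/ε)`
oscillates with amplitude of order one. The oscillation is an artefact of the coordinates. Along an
arc `y` inside `Ω^i`, the curve `x = G⁻¹(y)` is driven by `f^i` itself
(`IsArc.unstraighten_sub_eq_integral`), and `‖x - y‖ ≤ ε sup|g|`. Hence the displacement of `y` over
a fixed time `τ` is `∫ f^i(x, a)` up to an error that vanishes with `ε`.

This gives `exists_test_estimate`: running cost plus discounted increment of a test function `φ` is,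
up to `κτ + O(η)`, an integral of `Dφ(z)·f^i(z,a) + ℓ^i(z,a)`, where `η` bounds `ε|g|` and the
distance from the starting point to `z`. Combined with the two halves of dynamic programming
(`value_le_add_value`, `add_value_le_totalCost`) and bounds on the value functions that are uniform
on a compact ball, it yields the viscosity inequalities. The order of limits is essential: `η → 0`
with `τ` fixed, then `τ → 0` after division by `τ`, then `κ → 0`. A constant control gives the
subsolution property, a nearly optimal trajectory the supersolution property.

Trajectories exist because controllability supplies a control in `A^L` that keeps the state at rest
on `Γ`; elsewhere a constant control is followed until `Γ` is reached, if ever. -/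

namespace OscillatingInterface

namespace ControlProblem

variable {A : Type*}

/-! ### Admissible pairs and bounds on the data -/

theorem activeSide_of_mem_halfPlane (P : ControlProblem A) {i : Side} {z : Plane}
    (hz : z ∈ halfPlane i) (a : A) : P.activeSide z a = i := by
  cases i
  · simp [activeSide, hz]
  · have : z ∉ halfPlane Side.L := fun h => lt_asymm (show z 0 < 0 from h) hz
    simp [activeSide, hz, this]

theorem mem_ctrl_activeSide {P : ControlProblem A} {z : Plane} {a : A}
    (h : (z, a) ∈ P.admissiblePairs) : a ∈ P.ctrl (P.activeSide z a) := by
  unfold activeSide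
  split_ifs with h1 h2 h3
  · exact h.1 _ h1
  · exact h.1 _ h2
  · exact h3
  · refine (h.2 ?_).resolve_left h3
    exact le_antisymm (not_lt.1 h2) (not_lt.1 h1)

theorem dynamics_of_mem_halfPlane (P : ControlProblem A) (ε : ℝ) {i : Side} {z : Plane}
    (hz : z ∈ halfPlane i) (a : A) : P.dynamics ε z a = P.sideDynamics ε i z a := by
  rw [dynamics, P.activeSide_of_mem_halfPlane hz]

theorem runningCost_of_mem_halfPlane (P : ControlProblem A) (ε : ℝ) {i : Side} {z : Plane}
    (hz : z ∈ halfPlane i) (a : A) : P.runningCost ε z a = P.sideCost ε i z a := by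
  rw [runningCost, P.activeSide_of_mem_halfPlane hz]

theorem mem_admissiblePairs_of_mem_halfPlane (P : ControlProblem A) {i : Side} {z : Plane}
    (hz : z ∈ halfPlane i) {a : A} (ha : a ∈ P.ctrl i) : (z, a) ∈ P.admissiblePairs := by
  refine ⟨fun j hj => ?_, fun h0 => ?_⟩
  · rw [← P.activeSide_of_mem_halfPlane hj a, P.activeSide_of_mem_halfPlane hz a]
    exact ha
  · cases i
    · exact absurd h0 (ne_of_lt hz)
    · exact absurd h0 (ne_of_gt hz)

theorem mem_admissiblePairs_of_mem_interface (P : ControlProblem A) {i : Side} {z : Plane}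
    (hz : z ∈ straightInterface) {a : A} (ha : a ∈ P.ctrl i) : (z, a) ∈ P.admissiblePairs := by
  refine ⟨fun j hj => ?_, fun _ => ?_⟩
  · cases j
    · exact absurd hz (ne_of_lt hj)
    · exact absurd hz (ne_of_gt hj)
  · cases i
    · exact Or.inl ha
    · exact Or.inr ha

theorem isOpen_halfPlane (i : Side) : IsOpen (halfPlane i) := by
  cases i
  · exact isOpen_lt (by fun_prop) continuous_const
  · exact isOpen_lt continuous_const (by fun_prop)

theorem sideDynamics_zero_apply (P : ControlProblem A) (ε : ℝ) (i : Side) (z : Plane) (a : A) :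
    P.sideDynamics ε i z a 0 = P.f i (P.unstraighten ε z) a 0
      - deriv P.g (z 1 / ε) * P.f i (P.unstraighten ε z) a 1 := by
  simp [sideDynamics, jacobian, dotProduct, Fin.sum_univ_two]
  ring

theorem sideDynamics_one_apply (P : ControlProblem A) (ε : ℝ) (i : Side) (z : Plane) (a : A) :
    P.sideDynamics ε i z a 1 = P.f i (P.unstraighten ε z) a 1 := by
  simp [sideDynamics, jacobian, dotProduct, Fin.sum_univ_two]

theorem unstraighten_sub (P : ControlProblem A) (ε : ℝ) (z : Plane) :
    P.unstraighten ε z - z = EuclideanSpace.single 0 (ε * P.g (z 1 / ε)) := by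
  ext j
  fin_cases j <;> simp [unstraighten]

theorem norm_unstraighten_sub (P : ControlProblem A) (ε : ℝ) (z : Plane) :
    ‖P.unstraighten ε z - z‖ = |ε| * |P.g (z 1 / ε)| := by
  rw [unstraighten_sub, EuclideanSpace.single, PiLp.norm_single, Real.norm_eq_abs, abs_mul]

end ControlProblem

theorem norm_le_abs_add_abs (v : Plane) : ‖v‖ ≤ |v 0| + |v 1| := by
  rw [EuclideanSpace.norm_eq, Fin.sum_univ_two]
  refine Real.sqrt_le_iff.2 ⟨by positivity, ?_⟩
  simp only [Real.norm_eq_abs]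
  nlinarith [mul_nonneg (abs_nonneg (v 0)) (abs_nonneg (v 1))]

theorem abs_apply_le_norm (v : Plane) (j : Fin 2) : |v j| ≤ ‖v‖ :=
  PiLp.norm_apply_le v j

theorem exists_abs_le_of_periodic {h : ℝ → ℝ} (hc : Continuous h) (hp : Function.Periodic h 1) :
    ∃ B : ℝ, 0 ≤ B ∧ ∀ s, |h s| ≤ B := by
  obtain ⟨B, hB⟩ := (isCompact_Icc (a := (0 : ℝ)) (b := 1)).exists_bound_of_continuousOn
    hc.continuousOn
  refine ⟨B, (norm_nonneg _).trans (hB 0 (by simp)), fun s => ?_⟩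
  obtain ⟨t, ht, hst⟩ := hp.exists_mem_Ico₀ one_pos s
  rw [hst]
  exact hB t ⟨ht.1, ht.2.le⟩

namespace ControlProblem

variable {A : Type*}

namespace StandingAssumptions

variable [MetricSpace A] {P : ControlProblem A}

theorem continuous_g (hP : P.StandingAssumptions) : Continuous P.g := hP.g_contDiff.continuous

theorem hasDerivAt_g (hP : P.StandingAssumptions) (s : ℝ) : HasDerivAt P.g (deriv P.g s) s :=
  (hP.g_contDiff.differentiable (by norm_num) s).hasDerivAt

theorem continuous_deriv_g (hP : P.StandingAssumptions) : Continuous (deriv P.g) :=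
  hP.g_contDiff.continuous_deriv (by norm_num)

theorem exists_abs_g_le (hP : P.StandingAssumptions) : ∃ B : ℝ, 0 ≤ B ∧ ∀ s, |P.g s| ≤ B :=
  exists_abs_le_of_periodic hP.continuous_g hP.g_periodic

theorem exists_abs_deriv_g_le (hP : P.StandingAssumptions)
    : ∃ B : ℝ, 0 ≤ B ∧ ∀ s, |deriv P.g s| ≤ B := by
  refine exists_abs_le_of_periodic hP.continuous_deriv_g fun s => ?_
  rw [← deriv_comp_add_const]
  congr 1
  exact funext hP.g_periodic

theorem exists_norm_sideDynamics_le (hP : P.StandingAssumptions) :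
    ∃ K : ℝ≥0, ∀ ε i z, ∀ a ∈ P.ctrl i, ‖P.sideDynamics ε i z a‖ ≤ K := by
  obtain ⟨B, hB0, hB⟩ := hP.exists_abs_deriv_g_le
  obtain ⟨M, hM⟩ := hP.f_bounded
  have hM0 : 0 ≤ M := by
    obtain ⟨a, ha⟩ := hP.ctrl_nonempty Side.L
    exact (norm_nonneg _).trans (hM Side.L 0 a ha)
  refine ⟨⟨2 * M + B * M, by positivity⟩, fun ε i z a ha => ?_⟩
  refine (norm_le_abs_add_abs _).trans ?_
  rw [sideDynamics_zero_apply, sideDynamics_one_apply]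
  have h0 := (abs_apply_le_norm _ 0).trans (hM i (P.unstraighten ε z) a ha)
  have h1 := (abs_apply_le_norm _ 1).trans (hM i (P.unstraighten ε z) a ha)
  have h2 := mul_le_mul (hB (z 1 / ε)) h1 (abs_nonneg _) hB0
  rw [← abs_mul] at h2
  have h3 := abs_sub (P.f i (P.unstraighten ε z) a 0)
    (deriv P.g (z 1 / ε) * P.f i (P.unstraighten ε z) a 1)
  change _ ≤ 2 * M + B * M
  linarith

theorem exists_norm_dynamics_le (hP : P.StandingAssumptions) :
    ∃ K : ℝ≥0, ∀ ε z a, (z, a) ∈ P.admissiblePairs → ‖P.dynamics ε z a‖ ≤ K := by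
  obtain ⟨K, hK⟩ := hP.exists_norm_sideDynamics_le
  exact ⟨K, fun ε z a h => hK ε _ z a (mem_ctrl_activeSide h)⟩

theorem exists_abs_runningCost_le (hP : P.StandingAssumptions) :
    ∃ M : ℝ, 0 ≤ M ∧ ∀ ε z a, (z, a) ∈ P.admissiblePairs → |P.runningCost ε z a| ≤ M := by
  obtain ⟨M, hM⟩ := hP.cost_bounded
  refine ⟨M, ?_, fun ε z a h => hM _ _ a (mem_ctrl_activeSide h)⟩
  obtain ⟨a, ha⟩ := hP.ctrl_nonempty Side.L
  exact (abs_nonneg _).trans (hM Side.L 0 a ha)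

theorem continuous_unstraighten (hP : P.StandingAssumptions)
    (ε : ℝ) : Continuous (P.unstraighten ε) := by
  have := hP.continuous_g
  unfold unstraighten
  fun_prop

end StandingAssumptions

/-! ### Measurability along trajectories -/

/-- Tietze extension. The data are continuous only over `A^i`, while composing with measurable
curves is simplest for globally continuous maps. -/
theorem exists_continuous_extension [MetricSpace A] {E : Type*} [NormedAddCommGroup E]
    [NormedSpace ℝ E] [FiniteDimensional ℝ E] {S : Set A} (hS : IsCompact S) {h : Plane → A → E}
    (hc : ContinuousOn (fun q : Plane × A => h q.1 q.2) (univ ×ˢ S)) :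
    ∃ D : Plane × A → E, Continuous D ∧ ∀ z, ∀ a ∈ S, D (z, a) = h z a := by
  obtain ⟨D, hD⟩ := ContinuousMap.exists_restrict_eq (isClosed_univ.prod hS.isClosed)
    ⟨_, continuousOn_iff_continuous_domRestrict.1 hc⟩
  refine ⟨D, D.continuous, fun z a ha => ?_⟩
  exact congrArg (fun k => k ⟨(z, a), mem_univ z, ha⟩) hD

/-- The active side is decided by membership in two open half-planes and the closed set `A^L`, so
the composite is a measurable case distinction between two continuous expressions. -/
theorem aestronglyMeasurable_comp_activeSide [MetricSpace A] (P : ControlProblem A)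
    (hc : IsCompact (P.ctrl Side.L)) {E : Type*} [NormedAddCommGroup E]
    {D : Side → Plane × A → E} (hD : ∀ i, Continuous (D i)) {μ : Measure ℝ}
    {y : ℝ → Plane} {a : ℝ → A} (hy : AEStronglyMeasurable y μ) (ha : AEStronglyMeasurable a μ) :
    AEStronglyMeasurable (fun t => D (P.activeSide (y t) (a t)) (y t, a t)) μ := by
  classical
  let _ : MeasurableSpace A := borel A
  have : BorelSpace A := ⟨rfl⟩
  have key : ∀ {y : ℝ → Plane} {a : ℝ → A}, StronglyMeasurable y → StronglyMeasurable a →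
      StronglyMeasurable (fun t => D (P.activeSide (y t) (a t)) (y t, a t)) := by
    intro y a hy ha
    have h : ∀ i, StronglyMeasurable fun t => D i (y t, a t) := fun i =>
      (hD i).comp_stronglyMeasurable (hy.prodMk ha)
    have hL : ∀ i, MeasurableSet {t | y t ∈ halfPlane i} := fun i =>
      hy.measurable (isOpen_halfPlane i).measurableSet
    have hA : MeasurableSet {t | a t ∈ P.ctrl Side.L} := ha.measurable hc.isClosed.measurableSet
    have hite : StronglyMeasurable fun t => if y t ∈ halfPlane Side.L then D Side.L (y t, a t)
        else if y t ∈ halfPlane Side.R then D Side.R (y t, a t)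
        else if a t ∈ P.ctrl Side.L then D Side.L (y t, a t) else D Side.R (y t, a t) :=
      (h _).ite (hL _) ((h _).ite (hL _) ((h _).ite hA (h _)))
    convert hite using 2 with t
    unfold activeSide
    split_ifs <;> rfl
  refine ⟨_, key hy.stronglyMeasurable_mk ha.stronglyMeasurable_mk, ?_⟩
  filter_upwards [hy.ae_eq_mk, ha.ae_eq_mk] with t h1 h2
  rw [← h1, ← h2]

namespace StandingAssumptions

variable [MetricSpace A] {P : ControlProblem A}

theorem aestronglyMeasurable_dynamics (hP : P.StandingAssumptions)
    (ε : ℝ) {μ : Measure ℝ} {y : ℝ → Plane} {a : ℝ → A}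
    (hy : AEStronglyMeasurable y μ) (ha : AEStronglyMeasurable a μ)
    (hadm : ∀ᵐ t ∂μ, (y t, a t) ∈ P.admissiblePairs) :
    AEStronglyMeasurable (fun t => P.dynamics ε (y t) (a t)) μ := by
  choose F hFc hF using fun i => exists_continuous_extension (hP.ctrl_compact i)
    (hP.f_continuous i)
  have hg := hP.continuous_deriv_g
  have hu := hP.continuous_unstraighten ε
  have := P.aestronglyMeasurable_comp_activeSide (hP.ctrl_compact _)
    (D := fun i q => WithLp.toLp 2 (P.jacobian ε q.1 *ᵥ (F i (P.unstraighten ε q.1, q.2)).ofLp))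
    (fun i => by
      have := hFc i
      have hJ : Continuous fun q : Plane × A => P.jacobian ε q.1 := by
        refine continuous_matrix fun j k => ?_
        fin_cases j <;> fin_cases k <;> simp [jacobian] <;> fun_prop
      exact (PiLp.continuous_toLp 2 _).comp
        (hJ.matrix_mulVec ((PiLp.continuous_ofLp 2 _).comp (by fun_prop)))) hy ha
  refine this.congr ?_
  filter_upwards [hadm] with t ht
  simp only [dynamics, sideDynamics, hF _ _ _ (mem_ctrl_activeSide ht)]

theorem aestronglyMeasurable_runningCost (hP : P.StandingAssumptions)
    (ε : ℝ) {μ : Measure ℝ} {y : ℝ → Plane} {a : ℝ → A}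
    (hy : AEStronglyMeasurable y μ) (ha : AEStronglyMeasurable a μ)
    (hadm : ∀ᵐ t ∂μ, (y t, a t) ∈ P.admissiblePairs) :
    AEStronglyMeasurable (fun t => P.runningCost ε (y t) (a t)) μ := by
  choose F hFc hF using fun i => exists_continuous_extension (hP.ctrl_compact i)
    (hP.cost_continuous i)
  have hu := hP.continuous_unstraighten ε
  have := P.aestronglyMeasurable_comp_activeSide (hP.ctrl_compact _)
    (D := fun i q => F i (P.unstraighten ε q.1, q.2))
    (fun i => by have := hFc i; fun_prop) hy ha
  refine this.congr ?_
  filter_upwards [hadm] with t ht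
  simp only [runningCost, sideCost, hF _ _ _ (mem_ctrl_activeSide ht)]

end StandingAssumptions

end ControlProblem

namespace ControlProblem

variable {A : Type*}

/-! ### Arcs of trajectories -/

/-- The pair `(y, a)` is an admissible state-control pair on the time interval `[s, t]`. -/
structure IsArc [MetricSpace A] (P : ControlProblem A) (ε s t : ℝ) (y : ℝ → Plane) (a : ℝ → A) :
    Prop where
  control_measurable : AEStronglyMeasurable a (volume.restrict (Ioc s t))
  admissible : ∀ᵐ r ∂(volume.restrict (Ioc s t)), (y r, a r) ∈ P.admissiblePairs
  continuousOn : ContinuousOn y (Icc s t)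
  integral_eq : ∀ r ∈ Icc s t, y r = y s + ∫ u in s..r, P.dynamics ε (y u) (a u)

namespace IsArc

variable [MetricSpace A] {P : ControlProblem A} {ε s t : ℝ} {y : ℝ → Plane} {a : ℝ → A}

/-- Controls need to agree only on the half-open interval, so the control value at a junction time
is irrelevant when arcs are glued. -/
theorem congr (h : P.IsArc ε s t y a) (hst : s ≤ t) {y' : ℝ → Plane} {a' : ℝ → A}
    (hy : EqOn y' y (Icc s t)) (ha : EqOn a' a (Ioc s t)) : P.IsArc ε s t y' a' := by
  have hmem : ∀ᵐ r ∂(volume.restrict (Ioc s t)), r ∈ Ioc s t :=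
    ae_restrict_mem measurableSet_Ioc
  refine ⟨h.control_measurable.congr ?_, ?_, h.continuousOn.congr hy, fun r hr => ?_⟩
  · filter_upwards [hmem] with r hr using (ha hr).symm
  · filter_upwards [hmem, h.admissible] with r hr h'
    rw [hy (Ioc_subset_Icc_self hr), ha hr]
    exact h'
  · rw [hy hr, hy (left_mem_Icc.2 hst), h.integral_eq r hr]
    congr 1
    refine intervalIntegral.integral_congr_uIoo fun u hu => ?_
    rw [uIoo_of_le hr.1] at hu
    have hu' : u ∈ Ioc s t := ⟨hu.1, hu.2.le.trans hr.2⟩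
    simp only [hy (Ioc_subset_Icc_self hu'), ha hu']

theorem comp_add_right (h : P.IsArc ε s t y a) (c : ℝ) :
    P.IsArc ε (s - c) (t - c) (fun r => y (r + c)) (fun r => a (r + c)) := by
  have hmp : MeasurePreserving (fun r : ℝ => r + c) (volume.restrict (Ioc (s - c) (t - c)))
      (volume.restrict (Ioc s t)) := by
    have := (measurePreserving_add_right volume c).restrict_preimage
      (measurableSet_Ioc (a := s) (b := t))
    simpa using this
  refine ⟨h.control_measurable.comp_measurePreserving hmp,
    hmp.quasiMeasurePreserving.ae h.admissible, ?_, fun r hr => ?_⟩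
  · refine h.continuousOn.comp (by fun_prop) fun r hr => ?_
    exact ⟨by linarith [hr.1], by linarith [hr.2]⟩
  · rw [intervalIntegral.integral_comp_add_right (fun u => P.dynamics ε (y u) (a u)) c,
      sub_add_cancel]
    exact h.integral_eq (r + c) ⟨by linarith [hr.1], by linarith [hr.2]⟩

theorem aestronglyMeasurable (h : P.IsArc ε s t y a) :
    AEStronglyMeasurable y (volume.restrict (Ioc s t)) :=
  (h.continuousOn.mono Ioc_subset_Icc_self).aestronglyMeasurable measurableSet_Ioc

theorem intervalIntegrable_dynamics (hP : P.StandingAssumptions) (h : P.IsArc ε s t y a)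
    (hst : s ≤ t) : IntervalIntegrable (fun u => P.dynamics ε (y u) (a u)) volume s t := by
  obtain ⟨K, hK⟩ := hP.exists_norm_dynamics_le
  rw [intervalIntegrable_iff_integrableOn_Ioc_of_le hst]
  refine IntegrableOn.of_bound (by simp) (hP.aestronglyMeasurable_dynamics ε
    h.aestronglyMeasurable h.control_measurable h.admissible) K ?_
  filter_upwards [h.admissible] with r hr using hK _ _ _ hr

theorem intervalIntegrable_runningCost (hP : P.StandingAssumptions) (h : P.IsArc ε s t y a)
    (hst : s ≤ t) : IntervalIntegrable (fun u => P.runningCost ε (y u) (a u)) volume s t := by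
  obtain ⟨M, -, hM⟩ := hP.exists_abs_runningCost_le
  rw [intervalIntegrable_iff_integrableOn_Ioc_of_le hst]
  refine IntegrableOn.of_bound (by simp) (hP.aestronglyMeasurable_runningCost ε
    h.aestronglyMeasurable h.control_measurable h.admissible) M ?_
  filter_upwards [h.admissible] with r hr using hM _ _ _ hr

theorem mono (hP : P.StandingAssumptions) (h : P.IsArc ε s t y a) {s' t' : ℝ} (hs : s ≤ s')
    (hst : s' ≤ t') (ht : t' ≤ t) : P.IsArc ε s' t' y a := by
  have hint := h.intervalIntegrable_dynamics hP (hs.trans (hst.trans ht))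
  refine ⟨h.control_measurable.mono_set (Ioc_subset_Ioc hs ht),
    ae_restrict_of_ae_restrict_of_subset (Ioc_subset_Ioc hs ht) h.admissible,
    h.continuousOn.mono (Icc_subset_Icc hs ht), fun r hr => ?_⟩
  rw [h.integral_eq r ⟨hs.trans hr.1, hr.2.trans ht⟩, h.integral_eq s' ⟨hs, hst.trans ht⟩,
    add_assoc, intervalIntegral.integral_add_adjacent_intervals]
  · refine hint.mono_set ?_
    rw [uIcc_of_le hs, uIcc_of_le (hs.trans (hst.trans ht))]
    exact Icc_subset_Icc_right (hst.trans ht)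
  · refine hint.mono_set ?_
    rw [uIcc_of_le hr.1, uIcc_of_le (hs.trans (hst.trans ht))]
    exact Icc_subset_Icc hs (hr.2.trans ht)

theorem union (hP : P.StandingAssumptions) {m : ℝ} (h₁ : P.IsArc ε s m y a)
    (h₂ : P.IsArc ε m t y a) (hsm : s ≤ m) (hmt : m ≤ t) : P.IsArc ε s t y a := by
  refine ⟨?_, ?_, ?_, fun r hr => ?_⟩
  · rw [← Ioc_union_Ioc_eq_Ioc hsm hmt, aestronglyMeasurable_union_iff]
    exact ⟨h₁.control_measurable, h₂.control_measurable⟩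
  · rw [← Ioc_union_Ioc_eq_Ioc hsm hmt, ae_restrict_union_iff]
    exact ⟨h₁.admissible, h₂.admissible⟩
  · rw [← Icc_union_Icc_eq_Icc hsm hmt]
    exact h₁.continuousOn.union_of_isClosed h₂.continuousOn isClosed_Icc isClosed_Icc
  · rcases le_total r m with hrm | hmr
    · exact h₁.integral_eq r ⟨hr.1, hrm⟩
    · rw [h₂.integral_eq r ⟨hmr, hr.2⟩, h₁.integral_eq m ⟨hsm, le_rfl⟩, add_assoc,
        intervalIntegral.integral_add_adjacent_intervals
          (h₁.intervalIntegrable_dynamics hP hsm)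
          ((h₂.mono hP le_rfl hmr hr.2).intervalIntegrable_dynamics hP hmr)]

theorem norm_sub_le (hP : P.StandingAssumptions) {K : ℝ≥0}
    (hK : ∀ z a, (z, a) ∈ P.admissiblePairs → ‖P.dynamics ε z a‖ ≤ K) (h : P.IsArc ε s t y a)
    {r r' : ℝ} (hr : s ≤ r) (hrr : r ≤ r') (hr' : r' ≤ t) : ‖y r' - y r‖ ≤ K * (r' - r) := by
  have h' := h.mono hP hr hrr hr'
  rw [h'.integral_eq r' ⟨hrr, le_rfl⟩, add_sub_cancel_left]
  refine (intervalIntegral.norm_integral_le_of_norm_le_const_ae (C := K) ?_).trans_eq ?_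
  · rw [uIoc_of_le hrr, ← ae_restrict_iff' measurableSet_Ioc]
    filter_upwards [h'.admissible] with u hu using hK _ _ hu
  · rw [abs_of_nonneg (sub_nonneg.2 hrr)]

theorem lipschitzOnWith (hP : P.StandingAssumptions) {K : ℝ≥0}
    (hK : ∀ z a, (z, a) ∈ P.admissiblePairs → ‖P.dynamics ε z a‖ ≤ K) (h : P.IsArc ε s t y a) :
    LipschitzOnWith K y (Icc s t) := by
  refine LipschitzOnWith.of_dist_le_mul fun r hr r' hr' => ?_
  rcases le_total r r' with hrr | hrr
  · rw [dist_comm, dist_comm r, dist_eq_norm, Real.dist_eq, abs_of_nonneg (sub_nonneg.2 hrr)]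
    exact h.norm_sub_le hP hK hr.1 hrr hr'.2
  · rw [dist_eq_norm, Real.dist_eq, abs_of_nonneg (sub_nonneg.2 hrr)]
    exact h.norm_sub_le hP hK hr'.1 hrr hr.2

end IsArc

/-- Reduces shifting and gluing of trajectories to operations on finite arcs. Measurability and
admissibility pass to `[0,∞)` through a countable union, and the global Lipschitz bound comes from
the bounded dynamics. -/
theorem mem_trajectories_iff [MetricSpace A] {P : ControlProblem A} (hP : P.StandingAssumptions)
    {ε : ℝ} {z : Plane} {q : (ℝ → Plane) × (ℝ → A)} :
    q ∈ P.trajectories ε z ↔ q.1 0 = z ∧ ∀ T, 0 ≤ T → P.IsArc ε 0 T q.1 q.2 := by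
  constructor
  · rintro ⟨hm, hadm, ⟨K, hK⟩, heq⟩
    have h0 : q.1 0 = z := by simpa using heq 0 le_rfl
    have hsub : ∀ T : ℝ, Ioc 0 T ⊆ Ici 0 := fun T r hr => hr.1.le
    exact ⟨h0, fun T hT => ⟨hm.mono_set (hsub T),
      ae_restrict_of_ae_restrict_of_subset (hsub T) hadm,
      hK.continuousOn.mono fun r hr => hr.1, fun r hr => by rw [h0]; exact heq r hr.1⟩⟩
  · rintro ⟨rfl, h⟩
    obtain ⟨K, hK⟩ := hP.exists_norm_dynamics_le
    have hU : (⋃ n : ℕ, Ioc (0 : ℝ) n) = Ioi 0 := by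
      ext r
      simp only [mem_iUnion, mem_Ioc, mem_Ioi]
      refine ⟨fun ⟨_, hn⟩ => hn.1, fun hr => ?_⟩
      obtain ⟨n, hn⟩ := exists_nat_ge r
      exact ⟨n, hr, hn⟩
    refine ⟨?_, ?_, ⟨K, ?_⟩, fun t ht => (h t ht).integral_eq t ⟨ht, le_rfl⟩⟩
    · rw [← restrict_Ioi_eq_restrict_Ici, ← hU, aestronglyMeasurable_iUnion_iff]
      exact fun n => (h n n.cast_nonneg).control_measurable
    · rw [← restrict_Ioi_eq_restrict_Ici, ← hU, ae_restrict_iUnion_iff]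
      exact fun n => (h n n.cast_nonneg).admissible
    · intro r hr r' hr'
      have hT : 0 ≤ max r r' := le_max_of_le_left hr
      exact (h _ hT).lipschitzOnWith hP (hK ε) ⟨hr, le_max_left _ _⟩ ⟨hr', le_max_right _ _⟩

theorem exists_mem_trajectories_concat [MetricSpace A] {P : ControlProblem A}
    (hP : P.StandingAssumptions) {ε τ : ℝ} (hτ : 0 ≤ τ) {y : ℝ → Plane} {a : ℝ → A}
    (h : P.IsArc ε 0 τ y a) {q : (ℝ → Plane) × (ℝ → A)} (hq : q ∈ P.trajectories ε (y τ)) :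
    ∃ q' ∈ P.trajectories ε (y 0), EqOn q'.1 y (Icc 0 τ) ∧ EqOn q'.2 a (Ioc 0 τ) ∧
      ∀ t, 0 < t → q'.1 (t + τ) = q.1 t ∧ q'.2 (t + τ) = q.2 t := by
  obtain ⟨h0, hq⟩ := (mem_trajectories_iff hP).1 hq
  refine ⟨(fun t => if t ≤ τ then y t else q.1 (t - τ), fun t => if t ≤ τ then a t else q.2 (t - τ)),
    ?_, fun t ht => if_pos ht.2, fun t ht => if_pos ht.2, fun t ht => ?_⟩
  · refine (mem_trajectories_iff hP).2 ⟨if_pos hτ, fun T hT => ?_⟩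
    have h₁ := h.congr hτ (y' := fun t => if t ≤ τ then y t else q.1 (t - τ))
      (a' := fun t => if t ≤ τ then a t else q.2 (t - τ))
      (fun t ht => if_pos ht.2) (fun t ht => if_pos ht.2)
    rcases le_total T τ with hTτ | hTτ
    · exact h₁.mono hP le_rfl hT hTτ
    · refine h₁.union hP ?_ hτ hTτ
      have h₂ := (hq (T - τ) (sub_nonneg.2 hTτ)).comp_add_right (-τ)
      simp only [sub_neg_eq_add, sub_add_cancel, zero_add] at h₂
      refine h₂.congr hTτ (fun t ht => ?_) fun t ht => ?_
      · rcases ht.1.eq_or_lt with rfl | hlt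
        · simp [h0]
        · simp [not_le.2 hlt, sub_eq_add_neg]
      · simp [not_le.2 ht.1, sub_eq_add_neg]
  · have : ¬ t + τ ≤ τ := by linarith
    simp [this]

theorem tail_mem_trajectories [MetricSpace A] {P : ControlProblem A} (hP : P.StandingAssumptions)
    {ε τ : ℝ} (hτ : 0 ≤ τ) {z : Plane} {q : (ℝ → Plane) × (ℝ → A)}
    (hq : q ∈ P.trajectories ε z) :
    (fun t => q.1 (t + τ), fun t => q.2 (t + τ)) ∈ P.trajectories ε (q.1 τ) := by
  obtain ⟨-, hq⟩ := (mem_trajectories_iff hP).1 hq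
  refine (mem_trajectories_iff hP).2 ⟨by simp, fun T hT => ?_⟩
  have := ((hq (T + τ) (by linarith)).mono hP hτ (by linarith) le_rfl).comp_add_right τ
  simpa using this

/-! ### The cost functional and dynamic programming -/

section Cost

variable [MetricSpace A] {P : ControlProblem A}

theorem StandingAssumptions.exists_abs_totalCost_le (hP : P.StandingAssumptions) :
    ∃ C : ℝ, 0 ≤ C ∧ ∀ ε z, ∀ q ∈ P.trajectories ε z, |P.totalCost ε q| ≤ C := by
  obtain ⟨M, hM0, hM⟩ := hP.exists_abs_runningCost_le
  have hl := hP.discount_pos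
  have hexp : IntegrableOn (fun t => M * Real.exp (-P.discount * t)) (Ioi 0) :=
    (integrableOn_exp_mul_Ioi (neg_lt_zero.2 hl) 0).const_mul M
  refine ⟨∫ t in Ioi (0 : ℝ), M * Real.exp (-P.discount * t),
    integral_nonneg fun t => mul_nonneg hM0 (Real.exp_nonneg _), fun ε z q hq => ?_⟩
  refine norm_integral_le_of_norm_le (f := fun t =>
    P.runningCost ε (q.1 t) (q.2 t) * Real.exp (-P.discount * t)) hexp ?_
  rw [restrict_Ioi_eq_restrict_Ici]
  filter_upwards [hq.2.1] with t ht
  rw [norm_mul, Real.norm_eq_abs, Real.norm_eq_abs, Real.abs_exp]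
  exact mul_le_mul_of_nonneg_right (hM _ _ _ ht) (Real.exp_nonneg _)

theorem StandingAssumptions.exists_abs_value_le (hP : P.StandingAssumptions)
    : ∃ C : ℝ, ∀ ε z, |P.value ε z| ≤ C := by
  obtain ⟨C, hC0, hC⟩ := hP.exists_abs_totalCost_le
  refine ⟨C, fun ε z => abs_le.2 ⟨?_, ?_⟩⟩
  · refine Real.le_sInf ?_ (by linarith)
    rintro _ ⟨q, hq, rfl⟩
    exact (abs_le.1 (hC ε z q hq)).1
  · rcases (P.trajectories ε z).eq_empty_or_nonempty with h | ⟨q, hq⟩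
    -- With no trajectory the value is `sInf ∅ = 0`, so the bound holds for every `ε`.
    · simpa [value, h] using hC0
    · refine (csInf_le ⟨-C, ?_⟩ (mem_image_of_mem _ hq)).trans (abs_le.1 (hC ε z q hq)).2
      rintro _ ⟨q', hq', rfl⟩
      exact (abs_le.1 (hC ε z q' hq')).1

theorem value_le_totalCost (hP : P.StandingAssumptions)
    {ε : ℝ} {z : Plane} {q : (ℝ → Plane) × (ℝ → A)}
    (hq : q ∈ P.trajectories ε z) : P.value ε z ≤ P.totalCost ε q := by
  obtain ⟨C, -, hC⟩ := hP.exists_abs_totalCost_le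
  refine csInf_le ⟨-C, ?_⟩ (mem_image_of_mem _ hq)
  rintro _ ⟨q', hq', rfl⟩
  exact (abs_le.1 (hC ε z q' hq')).1

theorem integrableOn_totalCost (hP : P.StandingAssumptions)
    {ε : ℝ} {z : Plane} {q : (ℝ → Plane) × (ℝ → A)}
    (hq : q ∈ P.trajectories ε z) :
    IntegrableOn (fun t => P.runningCost ε (q.1 t) (q.2 t) * Real.exp (-P.discount * t))
      (Ioi 0) := by
  obtain ⟨M, hM0, hM⟩ := hP.exists_abs_runningCost_le
  obtain ⟨hm, hadm, ⟨K, hK⟩, -⟩ := hq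
  rw [← restrict_Ioi_eq_restrict_Ici] at hm hadm
  have hy : AEStronglyMeasurable q.1 (volume.restrict (Ioi 0)) :=
    (hK.continuousOn.mono Ioi_subset_Ici_self).aestronglyMeasurable measurableSet_Ioi
  refine Integrable.mono' (g := fun t => M * Real.exp (-P.discount * t))
    ((integrableOn_exp_mul_Ioi (neg_lt_zero.2 hP.discount_pos) 0).const_mul M)
    ((hP.aestronglyMeasurable_runningCost ε hy hm hadm).mul
      (by fun_prop : Continuous fun t => Real.exp (-P.discount * t)).aestronglyMeasurable) ?_
  filter_upwards [hadm] with t ht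
  rw [norm_mul, Real.norm_eq_abs, Real.norm_eq_abs, Real.abs_exp]
  exact mul_le_mul_of_nonneg_right (hM _ _ _ ht) (Real.exp_nonneg _)

theorem totalCost_eq_add (hP : P.StandingAssumptions)
    {ε τ : ℝ} (hτ : 0 ≤ τ) {z : Plane} {q q' : (ℝ → Plane) × (ℝ → A)}
    (hq : q ∈ P.trajectories ε z)
    (hq' : ∀ t, 0 < t → q.1 (t + τ) = q'.1 t ∧ q.2 (t + τ) = q'.2 t) :
    P.totalCost ε q =
      (∫ t in (0 : ℝ)..τ, P.runningCost ε (q.1 t) (q.2 t) * Real.exp (-P.discount * t)) +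
        Real.exp (-P.discount * τ) * P.totalCost ε q' := by
  have hint := integrableOn_totalCost hP hq
  rw [totalCost, ← Ioc_union_Ioi_eq_Ioi hτ,
    setIntegral_union (Ioc_disjoint_Ioi (le_refl τ)) measurableSet_Ioi
      (hint.mono_set Ioc_subset_Ioi_self) (hint.mono_set (Ioi_subset_Ioi hτ)),
    intervalIntegral.integral_of_le hτ]
  congr 1
  have h1 := (measurePreserving_add_right (volume : Measure ℝ) τ).setIntegral_preimage_emb
    (measurableEmbedding_addRight τ)
    (fun t => P.runningCost ε (q.1 t) (q.2 t) * Real.exp (-P.discount * t)) (Ioi τ)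
  have h2 : (fun r : ℝ => r + τ) ⁻¹' Ioi τ = Ioi 0 := by ext r; simp
  rw [← h1, h2, totalCost, ← integral_const_mul]
  refine setIntegral_congr_fun measurableSet_Ioi fun t (ht : 0 < t) => ?_
  simp only [(hq' t ht).1, (hq' t ht).2]
  rw [mul_add, Real.exp_add]
  ring

/-- Half of dynamic programming: the tail of a trajectory competes in the problem started at its
position at time `τ`. -/
theorem add_value_le_totalCost (hP : P.StandingAssumptions)
    {ε τ : ℝ} (hτ : 0 ≤ τ) {z : Plane} {q : (ℝ → Plane) × (ℝ → A)}
    (hq : q ∈ P.trajectories ε z) :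
    (∫ t in (0 : ℝ)..τ, P.runningCost ε (q.1 t) (q.2 t) * Real.exp (-P.discount * t)) +
        Real.exp (-P.discount * τ) * P.value ε (q.1 τ) ≤ P.totalCost ε q := by
  rw [totalCost_eq_add hP hτ hq
    (q' := (fun t => q.1 (t + τ), fun t => q.2 (t + τ))) fun t _ => ⟨rfl, rfl⟩]
  have := value_le_totalCost hP (tail_mem_trajectories hP hτ hq)
  gcongr

/-- The other half: the arc is continued by a nearly optimal trajectory. Nonemptiness excludes the
default value `sInf ∅ = 0`. -/
theorem value_le_add_value (hP : P.StandingAssumptions)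
    {ε τ : ℝ} (hτ : 0 ≤ τ) {y : ℝ → Plane} {a : ℝ → A}
    (h : P.IsArc ε 0 τ y a) (hne : (P.trajectories ε (y τ)).Nonempty) :
    P.value ε (y 0) ≤
      (∫ t in (0 : ℝ)..τ, P.runningCost ε (y t) (a t) * Real.exp (-P.discount * t)) +
        Real.exp (-P.discount * τ) * P.value ε (y τ) := by
  refine le_of_forall_pos_le_add fun δ hδ => ?_
  obtain ⟨_, ⟨q, hq, rfl⟩, hlt⟩ := exists_lt_of_csInf_lt (hne.image (P.totalCost ε))
    (lt_add_of_pos_right (P.value ε (y τ)) hδ)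
  obtain ⟨q', hq', hy, ha, htail⟩ := exists_mem_trajectories_concat hP hτ h hq
  refine (value_le_totalCost hP hq').trans ?_
  rw [totalCost_eq_add hP hτ hq' htail]
  have hI : (∫ t in (0 : ℝ)..τ, P.runningCost ε (q'.1 t) (q'.2 t) * Real.exp (-P.discount * t)) =
      ∫ t in (0 : ℝ)..τ, P.runningCost ε (y t) (a t) * Real.exp (-P.discount * t) := by
    refine intervalIntegral.integral_congr_uIoo fun t ht => ?_
    rw [uIoo_of_le hτ] at ht
    simp only [hy (Ioo_subset_Icc_self ht), ha (Ioo_subset_Ioc_self ht)]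
  have hexp : Real.exp (-P.discount * τ) ≤ 1 :=
    Real.exp_le_one_iff.2 (by nlinarith [hP.discount_pos])
  rw [hI]
  nlinarith [Real.exp_nonneg (-P.discount * τ)]

end Cost

end ControlProblem

/-! ### Global flows of bounded Lipschitz vector fields -/

/-- Picard–Lindelöf on growing time intervals, glued by uniqueness. -/
theorem exists_forall_hasDerivAt_of_lipschitzWith {E : Type*} [NormedAddCommGroup E]
    [NormedSpace ℝ E] [CompleteSpace E] {f : E → E} {K M : ℝ≥0} (hf : LipschitzWith K f)
    (hM : ∀ x, ‖f x‖ ≤ M) (x₀ : E) : ∃ x : ℝ → E, x 0 = x₀ ∧ ∀ t, HasDerivAt x (f (x t)) t := by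
  have hex : ∀ n : ℕ, ∃ α : ℝ → E, α 0 = x₀ ∧
      ∀ t ∈ Ioo (-(n + 1) : ℝ) (n + 1), HasDerivAt α (f (α t)) t := by
    intro n
    have hn : (0 : ℝ) < n + 1 := by positivity
    obtain ⟨α, h0, hα⟩ := IsPicardLindelof.exists_eq_forall_mem_Icc_hasDerivWithinAt₀
      -- The ball of radius `M(n+1)` contains everything reachable in time `n+1`, so no smallness of
      -- the time interval is required.
      (IsPicardLindelof.of_time_independent (f := f) (tmin := -(n + 1 : ℝ)) (tmax := n + 1)
        (t₀ := ⟨0, by constructor <;> linarith⟩) (x₀ := x₀) (a := M * (n + 1)) (r := 0) (L := M)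
        (K := K) (fun x _ => hM x) hf.lipschitzOnWith (by simp))
    exact ⟨α, h0, fun t ht => (hα t (Ioo_subset_Icc_self ht)).hasDerivAt
      (Icc_mem_nhds ht.1 ht.2)⟩
  choose α h0 hα using hex
  have huniq : ∀ n m : ℕ, n ≤ m → EqOn (α n) (α m) (Ioo (-(n + 1) : ℝ) (n + 1)) := by
    intro n m hnm
    have hn : (0 : ℝ) < n + 1 := by positivity
    have hnm' : (n : ℝ) ≤ m := Nat.cast_le.2 hnm
    refine ODE_solution_unique_of_mem_Ioo (v := fun _ => f) (s := fun _ => univ) (K := K) (t₀ := 0)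
      (fun t _ => hf.lipschitzOnWith) ⟨by linarith, by linarith⟩
      (fun t ht => ⟨hα n t ht, mem_univ _⟩) (fun t ht => ⟨hα m t ?_, mem_univ _⟩)
      ((h0 n).trans (h0 m).symm)
    exact ⟨by linarith [ht.1], by linarith [ht.2]⟩
  -- Solution `n` lives on `|t| < n+1`, which strictly contains `|t| ≤ n`. Near `t` all the chosen
  -- solutions therefore agree with the one of index `⌈|t|⌉₊ + 1`.
  refine ⟨fun t => α ⌈|t|⌉₊ t, by simp [h0], fun t => ?_⟩
  have hmem : ∀ {N : ℕ} {s : ℝ}, |s| < N + 1 → s ∈ Ioo (-(N + 1) : ℝ) (N + 1) := fun h =>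
    abs_lt.1 h
  have hself : ∀ s : ℝ, |s| < (⌈|s|⌉₊ : ℝ) + 1 := fun s => (Nat.le_ceil _).trans_lt (lt_add_one _)
  have hev : (fun s => α ⌈|s|⌉₊ s) =ᶠ[𝓝 t] α (⌈|t|⌉₊ + 1) := by
    have : ∀ᶠ s in 𝓝 t, |s| < (⌈|t|⌉₊ : ℝ) + 1 :=
      continuous_abs.continuousAt.eventually_lt continuousAt_const (hself t)
    filter_upwards [this] with s hs
    refine huniq _ _ (Nat.ceil_le.2 ?_) (hmem (hself s))
    push_cast
    exact hs.le
  have ht := hα (⌈|t|⌉₊ + 1) t (hmem (by push_cast; linarith [hself t]))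
  rw [← hev.self_of_nhds] at ht
  exact ht.congr_of_eventuallyEq hev

theorem mem_straightInterface_of_mem_closure {i : Side} {z : Plane}
    (h : z ∈ closure (halfPlane i)) (hz : z ∉ halfPlane i) : z ∈ straightInterface := by
  cases i
  · have : closure (halfPlane Side.L) ⊆ {z : Plane | z 0 ≤ 0} :=
      closure_minimal (fun w (hw : w 0 < 0) => hw.le) (isClosed_le (by fun_prop) continuous_const)
    exact le_antisymm (this h) (not_lt.1 hz)
  · have : closure (halfPlane Side.R) ⊆ {z : Plane | 0 ≤ z 0} :=
      closure_minimal (fun w (hw : 0 < w 0) => hw.le) (isClosed_le continuous_const (by fun_prop))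
    exact le_antisymm (not_lt.1 hz) (this h)

namespace ControlProblem

variable {A : Type*}

/-! ### The change of variables along trajectories -/

/-- `G(x) = (x₁ - ε g(x₂/ε), x₂)`, the inverse of `unstraighten`. -/
noncomputable def straighten (P : ControlProblem A) (ε : ℝ) (x : Plane) : Plane :=
  x - (ε * P.g (x 1 / ε)) • EuclideanSpace.single 0 1

theorem unstraighten_eq (P : ControlProblem A) (ε : ℝ) (z : Plane) :
    P.unstraighten ε z = z + (ε * P.g (z 1 / ε)) • EuclideanSpace.single 0 1 := by
  ext j
  fin_cases j <;> simp [unstraighten]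

theorem straighten_one_apply (P : ControlProblem A) (ε : ℝ) (x : Plane) :
    P.straighten ε x 1 = x 1 := by
  simp [straighten]

theorem unstraighten_one_apply (P : ControlProblem A) (ε : ℝ) (x : Plane) :
    P.unstraighten ε x 1 = x 1 := by
  simp [unstraighten]

theorem unstraighten_straighten (P : ControlProblem A) (ε : ℝ) (x : Plane) :
    P.unstraighten ε (P.straighten ε x) = x := by
  rw [unstraighten_eq, straighten_one_apply, straighten, sub_add_cancel]

theorem straighten_unstraighten (P : ControlProblem A) (ε : ℝ) (z : Plane) :
    P.straighten ε (P.unstraighten ε z) = z := by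
  rw [straighten, unstraighten_one_apply, unstraighten_eq, add_sub_cancel_right]

section Derivatives

variable [MetricSpace A] {P : ControlProblem A}

/-- The amplitude `ε` cancels the frequency `1/ε`: the profile is small but its slope is of order
one. -/
theorem hasDerivAt_profile (hP : P.StandingAssumptions)
    {ε : ℝ} (hε : ε ≠ 0) {x : ℝ → Plane} {v : Plane} {t : ℝ}
    (hx : HasDerivAt x v t) :
    HasDerivAt (fun s => ε * P.g (x s 1 / ε)) (deriv P.g (x t 1 / ε) * v 1) t := by
  have h1 : HasDerivAt (fun s => x s 1) (v 1) t :=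
    (EuclideanSpace.proj (𝕜 := ℝ) (1 : Fin 2)).hasFDerivAt.comp_hasDerivAt t hx
  have h2 := ((hP.hasDerivAt_g (x t 1 / ε)).comp t (h1.div_const ε)).const_mul ε
  refine h2.congr_deriv ?_
  field_simp

theorem hasDerivAt_straighten_comp (hP : P.StandingAssumptions)
    {ε : ℝ} (hε : ε ≠ 0) {i : Side} {a : A} {x : ℝ → Plane} {t : ℝ}
    (hx : HasDerivAt x (P.f i (x t) a) t) :
    HasDerivAt (fun s => P.straighten ε (x s))
      (P.sideDynamics ε i (P.straighten ε (x t)) a) t := by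
  refine (hx.sub ((hasDerivAt_profile hP hε hx).smul_const _)).congr_deriv ?_
  ext j
  fin_cases j
  · simp [sideDynamics_zero_apply, unstraighten_straighten, straighten_one_apply]
  · simp [sideDynamics_one_apply, unstraighten_straighten]

/-- The slope produced by the profile cancels the `-g'` in `J_ε`, leaving the non-oscillating field
`f^i`. -/
theorem hasDerivAt_unstraighten_comp (hP : P.StandingAssumptions)
    {ε : ℝ} (hε : ε ≠ 0) {i : Side} {a : A} {y : ℝ → Plane}
    {t : ℝ} (hy : HasDerivAt y (P.sideDynamics ε i (y t) a) t) :
    HasDerivAt (fun s => P.unstraighten ε (y s)) (P.f i (P.unstraighten ε (y t)) a) t := by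
  simp only [unstraighten_eq]
  refine (hy.add ((hasDerivAt_profile hP hε hy).smul_const _)).congr_deriv ?_
  rw [← unstraighten_eq]
  ext j
  fin_cases j
  · simp [sideDynamics_zero_apply, sideDynamics_one_apply]
  · simp [sideDynamics_one_apply]

theorem exists_lipschitzWith_unstraighten (hP : P.StandingAssumptions)
    : ∃ C : ℝ≥0, ∀ ε, LipschitzWith C (P.unstraighten ε) := by
  obtain ⟨B, hB0, hB⟩ := hP.exists_abs_deriv_g_le
  have hg : LipschitzWith ⟨B, hB0⟩ P.g :=
    lipschitzWith_of_nnnorm_deriv_le (hP.g_contDiff.differentiable (by norm_num)) fun s => hB s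
  refine ⟨1 + ⟨B, hB0⟩, fun ε => ?_⟩
  have h : LipschitzWith ⟨B, hB0⟩ fun z : Plane =>
      (ε * P.g (z 1 / ε)) • (EuclideanSpace.single 0 1 : Plane) := by
    refine LipschitzWith.of_dist_le_mul fun z w => ?_
    rw [dist_eq_norm, ← sub_smul, norm_smul, ← mul_sub, norm_mul, EuclideanSpace.single,
      PiLp.norm_single, norm_one, mul_one]
    change ‖ε‖ * ‖_‖ ≤ B * _
    have h1 := hg.dist_le_mul (z 1 / ε) (w 1 / ε)
    rw [dist_eq_norm, dist_eq_norm, ← sub_div, norm_div] at h1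
    change _ ≤ B * _ at h1
    have h2 : ‖z 1 - w 1‖ ≤ dist z w := by
      rw [dist_eq_norm]
      exact abs_apply_le_norm (z - w) 1
    -- At `ε = 0` the profile term vanishes; otherwise the two factors of `‖ε‖` cancel and the
    -- constant does not depend on `ε`.
    rcases eq_or_ne ε 0 with rfl | hε
    · simp only [norm_zero, zero_mul]
      positivity
    · have h3 : 0 < ‖ε‖ := norm_pos_iff.2 hε
      calc ‖ε‖ * ‖P.g (z 1 / ε) - P.g (w 1 / ε)‖ ≤ ‖ε‖ * (B * (‖z 1 - w 1‖ / ‖ε‖)) := by gcongr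
        _ = B * ‖z 1 - w 1‖ := by field_simp
        _ ≤ B * dist z w := by gcongr
  have := LipschitzWith.id.add h
  convert! this using 1
  exact funext fun z => P.unstraighten_eq ε z

theorem IsArc.ae_mem_ctrl {ε s t : ℝ} {y : ℝ → Plane} {a : ℝ → A} (h : P.IsArc ε s t y a)
    {i : Side} (hi : ∀ r ∈ Icc s t, y r ∈ halfPlane i) :
    ∀ᵐ r ∂(volume.restrict (Ioc s t)), a r ∈ P.ctrl i := by
  filter_upwards [h.admissible, ae_restrict_mem measurableSet_Ioc] with r hr hrm
  exact hr.1 i (hi r (Ioc_subset_Icc_self hrm))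

theorem IsArc.intervalIntegrable_f (hP : P.StandingAssumptions)
    {ε s t : ℝ} {y : ℝ → Plane} {a : ℝ → A}
    (h : P.IsArc ε s t y a) (hst : s ≤ t) {i : Side} (hi : ∀ r ∈ Icc s t, y r ∈ halfPlane i) :
    IntervalIntegrable (fun u => P.f i (P.unstraighten ε (y u)) (a u)) volume s t := by
  obtain ⟨M, hM⟩ := hP.f_bounded
  obtain ⟨F, hFc, hF⟩ := exists_continuous_extension (hP.ctrl_compact i) (hP.f_continuous i)
  have hctrl := h.ae_mem_ctrl hi
  rw [intervalIntegrable_iff_integrableOn_Ioc_of_le hst]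
  refine IntegrableOn.of_bound (by simp) ?_ M (hctrl.mono fun r hr => hM i _ _ hr)
  refine (hFc.comp_aestronglyMeasurable (((hP.continuous_unstraighten ε).comp_aestronglyMeasurable
    h.aestronglyMeasurable).prodMk h.control_measurable)).congr ?_
  filter_upwards [hctrl] with r hr using hF _ _ hr

/-- In original coordinates an arc inside `Ω^i` is driven by `f^i`. -/
theorem IsArc.unstraighten_sub_eq_integral (hP : P.StandingAssumptions)
    {ε s t : ℝ} (hε : ε ≠ 0) {y : ℝ → Plane} {a : ℝ → A}
    (h : P.IsArc ε s t y a) (hst : s ≤ t) {i : Side} (hi : ∀ r ∈ Icc s t, y r ∈ halfPlane i) :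
    P.unstraighten ε (y t) - P.unstraighten ε (y s) =
      ∫ u in s..t, P.f i (P.unstraighten ε (y u)) (a u) := by
  obtain ⟨K, hK⟩ := hP.exists_norm_dynamics_le
  obtain ⟨C, hC⟩ := exists_lipschitzWith_unstraighten hP
  obtain ⟨M, hM⟩ := hP.f_bounded
  have hint := h.intervalIntegrable_f hP hst hi
  have hsub : ∀ {r r'}, r ∈ Icc s t → r' ∈ Icc s t →
      IntervalIntegrable (fun u => P.f i (P.unstraighten ε (y u)) (a u)) volume r r' := by
    intro r r' hr hr'
    refine hint.mono_set ?_
    rw [uIcc_of_le hst]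
    exact uIcc_subset_Icc hr hr'
  have hM0 : 0 ≤ M := by
    obtain ⟨b, hb⟩ := hP.ctrl_nonempty Side.L
    exact (norm_nonneg _).trans (hM Side.L 0 b hb)
  have hlip1 : LipschitzOnWith (C * K) (fun r => P.unstraighten ε (y r)) (Icc s t) :=
    (hC ε).comp_lipschitzOnWith (h.lipschitzOnWith hP (hK ε))
  have hlip2 : LipschitzOnWith ⟨M, hM0⟩
      (fun r => ∫ u in s..r, P.f i (P.unstraighten ε (y u)) (a u)) (Icc s t) := by
    refine LipschitzOnWith.of_dist_le_mul fun r hr r' hr' => ?_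
    rw [dist_eq_norm, intervalIntegral.integral_interval_sub_left
      (hsub (left_mem_Icc.2 hst) hr) (hsub (left_mem_Icc.2 hst) hr'), Real.dist_eq]
    refine intervalIntegral.norm_integral_le_of_norm_le_const_ae ?_
    have := (ae_restrict_iff' measurableSet_Ioc).1 (h.ae_mem_ctrl hi)
    filter_upwards [this] with u hu hur
    refine hM i _ _ (hu ?_)
    exact ⟨(le_min hr'.1 hr.1).trans_lt hur.1, hur.2.trans (max_le hr'.2 hr.2)⟩
  -- The control is merely measurable, so the chain rule holds only almost everywhere. The
  -- difference of the two sides is Lipschitz, hence absolutely continuous, and its derivative is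
  -- zero almost everywhere; it is therefore constant.
  have hlip := hlip1.sub hlip2
  rw [← uIcc_of_le hst] at hlip
  obtain ⟨c, hc⟩ := hlip.absolutelyContinuousOnInterval.const_of_ae_hasDerivAt_zero (by
    have hne : ∀ b : ℝ, ∀ᵐ r : ℝ, r ≠ b := fun b => by simp [ae_iff]
    filter_upwards [hint.ae_hasDerivAt_integral, hne s, hne t,
      (h.intervalIntegrable_dynamics hP hst).ae_hasDerivAt_integral] with r h1 hrs hrt h2 hr
    have hr' := hr
    rw [uIcc_of_le hst] at hr'
    have hnhds : Icc s t ∈ 𝓝 r :=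
      Icc_mem_nhds (hr'.1.lt_of_ne' hrs) (hr'.2.lt_of_ne hrt)
    have hy : HasDerivAt y (P.sideDynamics ε i (y r) (a r)) r := by
      rw [← P.dynamics_of_mem_halfPlane ε (hi r hr')]
      refine ((h2 hr s left_mem_uIcc).const_add (y s)).congr_of_eventuallyEq ?_
      filter_upwards [hnhds] with u hu using h.integral_eq u hu
    have := (hasDerivAt_unstraighten_comp hP hε hy).sub (h1 hr s left_mem_uIcc)
    rwa [sub_self] at this)
  have hs := hc s left_mem_uIcc
  have ht := hc t right_mem_uIcc
  simp only [intervalIntegral.integral_same, sub_zero] at hs ht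
  rw [hs, ← ht]
  abel

/-! ### Existence of trajectories -/

/-- From every point and for every control value there is a solution of the state equation of
side `i` with that constant control. -/
theorem exists_flow (hP : P.StandingAssumptions)
    {ε : ℝ} (hε : ε ≠ 0) {i : Side} {a : A} (ha : a ∈ P.ctrl i) {K : ℝ≥0}
    (hK : ∀ z, ‖P.sideDynamics ε i z a‖ ≤ K) (z : Plane) :
    ∃ y : ℝ → Plane, y 0 = z ∧ LipschitzWith K y ∧ ∀ τ, 0 ≤ τ →
      (∀ t ∈ Ioo 0 τ, y t ∈ halfPlane i) → P.IsArc ε 0 τ y fun _ => a := by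
  obtain ⟨M, hM⟩ := hP.f_bounded
  obtain ⟨Lf, hL0, hL⟩ := hP.f_lipschitz
  have hlip : LipschitzWith ⟨Lf, hL0.le⟩ fun x => P.f i x a :=
    LipschitzWith.of_dist_le_mul fun x w => by
      rw [dist_eq_norm, dist_eq_norm]
      exact hL i x w a ha
  -- The equation is solved in the original coordinates, where the field is directly Lipschitz and
  -- bounded, and then transported by `straighten`.
  obtain ⟨x, hx0, hx⟩ := exists_forall_hasDerivAt_of_lipschitzWith
    (M := ⟨M, (norm_nonneg _).trans (hM i 0 a ha)⟩) hlip (fun x => hM i x a ha)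
    (P.unstraighten ε z)
  have hy := fun t => hasDerivAt_straighten_comp hP hε (hx t)
  have hcont : Continuous fun t => P.straighten ε (x t) :=
    continuous_iff_continuousAt.2 fun t => (hy t).continuousAt
  refine ⟨fun t => P.straighten ε (x t), ?_, ?_, fun τ hτ hmem => ?_⟩
  · simp only [hx0, straighten_unstraighten]
  · refine lipschitzWith_of_nnnorm_deriv_le (fun t => (hy t).differentiableAt) fun t => ?_
    rw [(hy t).deriv]
    exact hK _
  · have hdyn : Continuous fun t => P.sideDynamics ε i (P.straighten ε (x t)) a := by
      have h1 : Continuous fun t => P.f i (P.unstraighten ε (P.straighten ε (x t))) a :=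
        hlip.continuous.comp ((hP.continuous_unstraighten ε).comp hcont)
      have h2 : Continuous fun t => P.jacobian ε (P.straighten ε (x t)) := by
        have := hP.continuous_deriv_g
        refine continuous_matrix fun j k => ?_
        fin_cases j <;> fin_cases k <;> simp [jacobian] <;> fun_prop
      exact (PiLp.continuous_toLp 2 _).comp
        (h2.matrix_mulVec ((PiLp.continuous_ofLp 2 _).comp h1))
    refine ⟨aestronglyMeasurable_const, ?_, hcont.continuousOn, fun r hr => ?_⟩
    -- The final time, at which the solution may already be on `Γ`, is a null set.
    · rw [← restrict_Ioo_eq_restrict_Ioc]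
      filter_upwards [ae_restrict_mem measurableSet_Ioo] with t ht
      exact P.mem_admissiblePairs_of_mem_halfPlane (hmem t ht) ha
    · have hftc := intervalIntegral.integral_eq_sub_of_hasDerivAt (a := 0) (b := r)
        (fun t _ => hy t) (hdyn.intervalIntegrable 0 r)
      have hI : (∫ u in (0 : ℝ)..r, P.dynamics ε (P.straighten ε (x u)) a) =
          ∫ u in (0 : ℝ)..r, P.sideDynamics ε i (P.straighten ε (x u)) a := by
        refine intervalIntegral.integral_congr_uIoo fun u hu => ?_
        rw [uIoo_of_le hr.1] at hu
        exact P.dynamics_of_mem_halfPlane ε (hmem u ⟨hu.1, hu.2.trans_le hr.2⟩) a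
      rw [hI, hftc]
      abel

/-- Since `0` lies in the controllability ball, some control of `A^L` makes the dynamics vanish, and
the state rests at `z`. -/
theorem trajectories_nonempty_of_mem_interface (hP : P.StandingAssumptions) {ε δ : ℝ} (hδ : 0 < δ)
    (hc : ∀ x ∈ P.oscInterface ε, Metric.ball (0 : Plane) δ ⊆ P.f Side.L x '' P.ctrl Side.L)
    {z : Plane} (hz : z ∈ straightInterface) : (P.trajectories ε z).Nonempty := by
  have hz0 : z 0 = 0 := hz
  have hx : P.unstraighten ε z ∈ P.oscInterface ε := by
    simp [oscInterface, unstraighten, hz0]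
  obtain ⟨a, ha, hfa⟩ := hc _ hx (Metric.mem_ball_self hδ)
  have hside : P.activeSide z a = Side.L := by
    simp [activeSide, halfPlane, hz0, ha]
  have hdyn : P.dynamics ε z a = 0 := by
    simp [dynamics, hside, sideDynamics, hfa]
  refine ⟨(fun _ => z, fun _ => a), (mem_trajectories_iff hP).2 ⟨rfl, fun T _ =>
    ⟨aestronglyMeasurable_const, ae_of_all _ fun _ =>
      P.mem_admissiblePairs_of_mem_interface hz ha, continuousOn_const, fun r _ => ?_⟩⟩⟩
  simp [hdyn]

theorem trajectories_nonempty (hP : P.StandingAssumptions) {ε δ : ℝ} (hε : ε ≠ 0) (hδ : 0 < δ)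
    (hc : ∀ x ∈ P.oscInterface ε, Metric.ball (0 : Plane) δ ⊆ P.f Side.L x '' P.ctrl Side.L)
    (z : Plane) : (P.trajectories ε z).Nonempty := by
  by_cases hz : z ∈ straightInterface
  · exact trajectories_nonempty_of_mem_interface hP hδ hc hz
  obtain ⟨i, hi⟩ : ∃ i, z ∈ halfPlane i := by
    rcases lt_or_gt_of_ne (show z 0 ≠ 0 from hz) with h | h
    · exact ⟨Side.L, h⟩
    · exact ⟨Side.R, h⟩
  obtain ⟨a, ha⟩ := hP.ctrl_nonempty i
  obtain ⟨K, hK⟩ := hP.exists_norm_sideDynamics_le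
  obtain ⟨y, rfl, hyl, hy⟩ := exists_flow hP hε ha (fun w => hK ε i w a ha) z
  have hyc := hyl.continuous
  by_cases hstay : ∀ t, 0 ≤ t → y t ∈ halfPlane i
  · exact ⟨(y, fun _ => a), (mem_trajectories_iff hP).2 ⟨rfl, fun T hT =>
      hy T hT fun t ht => hstay t ht.1.le⟩⟩
  push Not at hstay
  -- `sInf S` is the first exit time from `Ω^i`. The exit point is a limit of points of `Ω^i`
  -- outside it, hence lies on `Γ`, where a resting trajectory can be attached.
  set S : Set ℝ := Ici 0 ∩ y ⁻¹' (halfPlane i)ᶜ with hS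
  have hSc : IsClosed S := isClosed_Ici.inter ((isOpen_halfPlane i).isClosed_compl.preimage hyc)
  have hSb : BddBelow S := ⟨0, fun t ht => ht.1⟩
  have hτS : sInf S ∈ S := hSc.csInf_mem hstay hSb
  have hlt : ∀ t ∈ Ico 0 (sInf S), y t ∈ halfPlane i := fun t ht => by
    by_contra hcon
    exact not_le.2 ht.2 (csInf_le hSb ⟨ht.1, hcon⟩)
  have hpos : 0 < sInf S := lt_of_le_of_ne hτS.1 fun h0 => hτS.2 (h0 ▸ hi)
  have hcl : y (sInf S) ∈ closure (halfPlane i) := by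
    refine hyc.continuousOn.image_closure (s := Ico 0 (sInf S)) |>.trans
      (closure_mono (image_subset_iff.2 hlt)) (mem_image_of_mem y ?_)
    rw [closure_Ico hpos.ne]
    exact right_mem_Icc.2 hpos.le
  obtain ⟨q, hq⟩ := trajectories_nonempty_of_mem_interface hP hδ hc
    (mem_straightInterface_of_mem_closure hcl hτS.2)
  obtain ⟨q', hq', -⟩ := exists_mem_trajectories_concat hP hpos.le
    (hy _ hpos.le fun t ht => hlt t (Ioo_subset_Ico_self ht)) hq
  exact ⟨q', hq'⟩

theorem eventually_trajectories_nonempty (hP : P.StandingAssumptions) :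
    ∀ᶠ ε in 𝓝[>] (0 : ℝ), ∀ z, (P.trajectories ε z).Nonempty := by
  obtain ⟨δ, hδ, ε₀, hε₀, hc⟩ := hP.controllable
  filter_upwards [Ioo_mem_nhdsGT hε₀] with ε hε z
  exact trajectories_nonempty hP hε.1.ne' hδ (hc ε hε.1 hε.2 Side.L) z

end Derivatives

end ControlProblem

/-! ### Small-time limits and uniformity on compact sets -/

/-- Turns a dynamic programming inequality into the differential one: `1 - e^{-lam τ}` has
derivative `lam` at `0`. The admissible range of `τ` may depend on `κ`, so `κ` goes to `0` last. -/
theorem mul_le_of_eventually_one_sub_exp {lam W c : ℝ}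
    (h : ∀ κ > 0, ∀ᶠ τ in 𝓝[>] (0 : ℝ), W * (1 - Real.exp (-lam * τ)) ≤ τ * (c + κ)) :
    lam * W ≤ c := by
  have hd : HasDerivAt (fun τ => W * (1 - Real.exp (-lam * τ))) (lam * W) 0 := by
    have h1 : HasDerivAt (fun τ => -lam * τ) (-lam) 0 := by
      simpa using (hasDerivAt_id (0 : ℝ)).const_mul (-lam)
    refine ((h1.exp.const_sub 1).const_mul W).congr_deriv ?_
    simp [mul_comm]
  have ht : Tendsto (slope (fun τ => W * (1 - Real.exp (-lam * τ))) 0) (𝓝[>] 0) (𝓝 (lam * W)) :=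
    (hasDerivAt_iff_tendsto_slope.1 hd).mono_left (nhdsWithin_mono 0 fun τ (hτ : 0 < τ) => hτ.ne')
  refine le_of_forall_pos_le_add fun κ hκ => le_of_tendsto ht ?_
  filter_upwards [h κ hκ, self_mem_nhdsWithin] with τ h1 (hτ : 0 < τ)
  simp only [slope, vsub_eq_sub, sub_zero, mul_zero, Real.exp_zero, sub_self, smul_eq_mul]
  rw [inv_mul_le_iff₀ hτ]
  exact h1

theorem eventually_forall_mem_of_isCompact {X Y : Type*} [TopologicalSpace Y] {l : Filter X}
    {K : Set Y} (hK : IsCompact K) {p : X → Y → Prop}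
    (h : ∀ y ∈ K, ∀ᶠ q in l ×ˢ 𝓝 y, p q.1 q.2) : ∀ᶠ x in l, ∀ y ∈ K, p x y := by
  obtain ⟨s, hs, t, ht, hst⟩ := mem_prod_iff.1 (hK.mem_prod_nhdsSet_of_forall h)
  filter_upwards [hs] with x hx y hy
  exact hst (mk_mem_prod hx (subset_of_mem_nhdsSet ht hy))

/-! ### Half-relaxed limits of bounded families -/

section Semilimits

variable {v : ℝ → Plane → ℝ} {C : ℝ}

theorem isBoundedUnder_le_of_abs_le (hC : ∀ ε z, |v ε z| ≤ C) (l : Filter (ℝ × Plane)) :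
    IsBoundedUnder (· ≤ ·) l fun q => v q.1 q.2 :=
  isBoundedUnder_of ⟨C, fun q => (abs_le.1 (hC q.1 q.2)).2⟩

theorem isBoundedUnder_ge_of_abs_le (hC : ∀ ε z, |v ε z| ≤ C) (l : Filter (ℝ × Plane)) :
    IsBoundedUnder (· ≥ ·) l fun q => v q.1 q.2 :=
  isBoundedUnder_of ⟨-C, fun q => (abs_le.1 (hC q.1 q.2)).1⟩

theorem abs_limsup_le (hC : ∀ ε z, |v ε z| ≤ C) (l : Filter (ℝ × Plane)) [l.NeBot] :
    |limsup (fun q => v q.1 q.2) l| ≤ C :=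
  abs_le.2 ⟨le_limsup_of_frequently_le
      (Frequently.of_forall fun q => (abs_le.1 (hC q.1 q.2)).1) (isBoundedUnder_le_of_abs_le hC l),
    limsup_le_of_le (isBoundedUnder_ge_of_abs_le hC l).isCoboundedUnder_le
      (Eventually.of_forall fun q => (abs_le.1 (hC q.1 q.2)).2)⟩

theorem abs_liminf_le (hC : ∀ ε z, |v ε z| ≤ C) (l : Filter (ℝ × Plane)) [l.NeBot] :
    |liminf (fun q => v q.1 q.2) l| ≤ C :=
  abs_le.2 ⟨le_liminf_of_le (isBoundedUnder_le_of_abs_le hC l).isCoboundedUnder_ge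
      (Eventually.of_forall fun q => (abs_le.1 (hC q.1 q.2)).1),
    liminf_le_of_frequently_le
      (Frequently.of_forall fun q => (abs_le.1 (hC q.1 q.2)).2)
      (isBoundedUnder_ge_of_abs_le hC l)⟩

/-- A neighbourhood of `z` on which `v` is bounded above is also a neighbourhood of every nearby
point, so the bound passes to the `limsup` there. -/
theorem upperSemicontinuous_limsup (hC : ∀ ε z, |v ε z| ≤ C) (l : Filter ℝ) [l.NeBot] :
    UpperSemicontinuous fun z => limsup (fun q : ℝ × Plane => v q.1 q.2) (l ×ˢ 𝓝 z) := by
  intro z c hc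
  obtain ⟨d, hd, hdc⟩ := exists_between (show limsup _ _ < c from hc)
  have hev := eventually_lt_of_limsup_lt hd (isBoundedUnder_le_of_abs_le hC _)
  obtain ⟨s, hs, t, ht, hst⟩ := mem_prod_iff.1 hev
  filter_upwards [eventually_mem_nhds_iff.2 ht] with w hw
  refine lt_of_le_of_lt ?_ hdc
  refine limsup_le_of_le (isBoundedUnder_ge_of_abs_le hC _).isCoboundedUnder_le ?_
  filter_upwards [prod_mem_prod hs hw] with q hq using (hst hq).le

theorem lowerSemicontinuous_liminf (hC : ∀ ε z, |v ε z| ≤ C) (l : Filter ℝ) [l.NeBot] :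
    LowerSemicontinuous fun z => liminf (fun q : ℝ × Plane => v q.1 q.2) (l ×ˢ 𝓝 z) := by
  intro z c hc
  obtain ⟨d, hcd, hd⟩ := exists_between (show c < liminf _ _ from hc)
  have hev := eventually_lt_of_lt_liminf hd (isBoundedUnder_ge_of_abs_le hC _)
  obtain ⟨s, hs, t, ht, hst⟩ := mem_prod_iff.1 hev
  filter_upwards [eventually_mem_nhds_iff.2 ht] with w hw
  refine lt_of_lt_of_le hcd ?_
  refine le_liminf_of_le (isBoundedUnder_le_of_abs_le hC _).isCoboundedUnder_ge ?_
  filter_upwards [prod_mem_prod hs hw] with q hq using (hst hq).le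

/-- A pointwise bound on the relaxed limit becomes uniform over a compact set. This replaces the
choice of maximum points of `v_ε - φ`, so test functions need not touch strictly and `v_ε` needs no
regularity. -/
theorem eventually_forall_le_of_limsup_le (hC : ∀ ε z, |v ε z| ≤ C)
    {l : Filter ℝ} [l.NeBot] {K : Set Plane}
    (hK : IsCompact K) {ψ : Plane → ℝ} (hψ : ∀ z ∈ K, ContinuousAt ψ z)
    (h : ∀ z ∈ K, limsup (fun q : ℝ × Plane => v q.1 q.2) (l ×ˢ 𝓝 z) ≤ ψ z) {η : ℝ} (hη : 0 < η) :
    ∀ᶠ ε in l, ∀ z ∈ K, v ε z ≤ ψ z + η := by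
  refine eventually_forall_mem_of_isCompact hK fun z hz => ?_
  have h1 := eventually_lt_of_limsup_lt
    (lt_of_le_of_lt (h z hz) (lt_add_of_pos_right _ (half_pos hη)))
    (isBoundedUnder_le_of_abs_le hC _)
  have h2 : ∀ᶠ q : ℝ × Plane in l ×ˢ 𝓝 z, ψ z - η / 2 < ψ q.2 :=
    ((hψ z hz).eventually (lt_mem_nhds (by linarith))).prod_inr l
  filter_upwards [h1, h2] with q hq1 hq2
  linarith

theorem eventually_forall_ge_of_le_liminf (hC : ∀ ε z, |v ε z| ≤ C)
    {l : Filter ℝ} [l.NeBot] {K : Set Plane}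
    (hK : IsCompact K) {ψ : Plane → ℝ} (hψ : ∀ z ∈ K, ContinuousAt ψ z)
    (h : ∀ z ∈ K, ψ z ≤ liminf (fun q : ℝ × Plane => v q.1 q.2) (l ×ˢ 𝓝 z)) {η : ℝ} (hη : 0 < η) :
    ∀ᶠ ε in l, ∀ z ∈ K, ψ z - η ≤ v ε z := by
  refine eventually_forall_mem_of_isCompact hK fun z hz => ?_
  have h1 := eventually_lt_of_lt_liminf
    (lt_of_lt_of_le (sub_lt_self _ (half_pos hη)) (h z hz))
    (isBoundedUnder_ge_of_abs_le hC _)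
  have h2 : ∀ᶠ q : ℝ × Plane in l ×ˢ 𝓝 z, ψ q.2 < ψ z + η / 2 :=
    ((hψ z hz).eventually (gt_mem_nhds (by linarith))).prod_inr l
  filter_upwards [h1, h2] with q hq1 hq2
  linarith

end Semilimits

namespace ControlProblem

variable {A : Type*} [MetricSpace A] {P : ControlProblem A}

/-! ### Expansion of the cost along short arcs -/

theorem exists_integrand_estimate (hP : P.StandingAssumptions)
    (i : Side) (z p : Plane) {κ : ℝ} (hκ : 0 < κ) :
    ∃ ρ > 0, ∀ s t : ℝ, s ∈ Icc 0 ρ → t ∈ Icc 0 ρ → ∀ x, ‖x - z‖ ≤ ρ → ∀ a ∈ P.ctrl i,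
      |(P.cost i x a * Real.exp (-P.discount * s) +
        Real.exp (-P.discount * t) * inner ℝ p (P.f i x a)) -
        (inner ℝ p (P.f i z a) + P.cost i z a)| ≤ κ := by
  obtain ⟨M, hM⟩ := hP.f_bounded
  obtain ⟨N, hN⟩ := hP.cost_bounded
  obtain ⟨Lf, hL0, hL⟩ := hP.f_lipschitz
  obtain ⟨ω, hω0, hωc, hω⟩ := hP.cost_modulus
  have hl := hP.discount_pos
  have hωev : ∀ᶠ s in 𝓝[≥] (0 : ℝ), ω s < κ / 2 :=
    hωc.eventually (gt_mem_nhds (by rw [hω0]; exact half_pos hκ))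
  obtain ⟨ρ₁, hρ₁, hωρ⟩ := mem_nhdsGE_iff_exists_Icc_subset.1 hωev
  obtain ⟨b, hb⟩ := hP.ctrl_nonempty i
  have hM0 : 0 ≤ M := (norm_nonneg _).trans (hM i 0 b hb)
  have hN0 : 0 ≤ N := (abs_nonneg _).trans (hN i 0 b hb)
  -- Three errors linear in `ρ`: the discount on the cost, the discount on the inner product, and
  -- the Lipschitz variation of `f`. They share `κ/2`; the modulus of the cost uses the other half.
  set D : ℝ := N * P.discount + ‖p‖ * M * P.discount + ‖p‖ * Lf with hD
  have hD0 : 0 ≤ D := by positivity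
  set ρ := min ρ₁ (κ / 2 / (D + 1)) with hρ
  have hρ0 : 0 < ρ := lt_min hρ₁ (by positivity)
  have hρD : D * ρ ≤ κ / 2 := by
    have h1 : ρ * (D + 1) ≤ κ / 2 := (le_div_iff₀ (by positivity)).1 (min_le_right _ _)
    nlinarith
  have hexp : ∀ s ∈ Icc 0 ρ, 0 ≤ 1 - Real.exp (-P.discount * s) ∧
      1 - Real.exp (-P.discount * s) ≤ P.discount * ρ := by
    intro s hs
    constructor
    · have : Real.exp (-P.discount * s) ≤ 1 := Real.exp_le_one_iff.2 (by nlinarith [hs.1])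
      linarith
    · have := Real.add_one_le_exp (-P.discount * s)
      nlinarith [mul_le_mul_of_nonneg_left hs.2 hl.le]
  refine ⟨ρ, hρ0, fun s t hs ht x hx a ha => ?_⟩
  have e1 := hexp s hs
  have e2 := hexp t ht
  have c1 : |P.cost i x a * (1 - Real.exp (-P.discount * s))| ≤ N * (P.discount * ρ) := by
    rw [abs_mul, abs_of_nonneg e1.1]
    exact mul_le_mul (hN i x a ha) e1.2 e1.1 hN0
  have c2 : |P.cost i x a - P.cost i z a| ≤ κ / 2 :=
    (hω i x z a ha).trans (hωρ ⟨norm_nonneg _, hx.trans (min_le_left _ _)⟩).le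
  have c3 : |(1 - Real.exp (-P.discount * t)) * inner ℝ p (P.f i x a)| ≤
      P.discount * ρ * (‖p‖ * M) := by
    rw [abs_mul, abs_of_nonneg e2.1]
    refine mul_le_mul e2.2 ((abs_real_inner_le_norm _ _).trans ?_) (abs_nonneg _) (by positivity)
    exact mul_le_mul_of_nonneg_left (hM i x a ha) (norm_nonneg _)
  have c4 : |inner ℝ p (P.f i x a - P.f i z a)| ≤ ‖p‖ * (Lf * ρ) := by
    refine (abs_real_inner_le_norm _ _).trans (mul_le_mul_of_nonneg_left ?_ (norm_nonneg _))
    exact (hL i x z a ha).trans (mul_le_mul_of_nonneg_left hx hL0.le)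
  rw [inner_sub_right] at c4
  rw [abs_le] at c1 c2 c3 c4 ⊢
  constructor <;> nlinarith

/-- The displacement is measured in the original coordinates, where it is exactly `∫ f^i`, so no
oscillating term appears. The lower bound serves the supersolution, the upper bound the subsolution.
-/
theorem exists_cost_estimate (hP : P.StandingAssumptions)
    (i : Side) (z p : Plane) {κ : ℝ} (hκ : 0 < κ) :
    ∃ ρ > 0, ∀ ε : ℝ, ε ≠ 0 → ∀ τ ∈ Icc 0 ρ, ∀ (y : ℝ → Plane) (a : ℝ → A),
      P.IsArc ε 0 τ y a →
      (∀ r ∈ Icc 0 τ, y r ∈ halfPlane i ∧ ‖P.unstraighten ε (y r) - z‖ ≤ ρ) → ∀ c : ℝ,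
      ((∀ᵐ t ∂(volume.restrict (Ioc 0 τ)),
          c ≤ inner ℝ p (P.f i z (a t)) + P.cost i z (a t)) →
        τ * (c - κ) ≤
          (∫ t in (0 : ℝ)..τ, P.runningCost ε (y t) (a t) * Real.exp (-P.discount * t)) +
            Real.exp (-P.discount * τ) *
              inner ℝ p (P.unstraighten ε (y τ) - P.unstraighten ε (y 0))) ∧
      ((∀ᵐ t ∂(volume.restrict (Ioc 0 τ)),
          inner ℝ p (P.f i z (a t)) + P.cost i z (a t) ≤ c) →
        (∫ t in (0 : ℝ)..τ, P.runningCost ε (y t) (a t) * Real.exp (-P.discount * t)) +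
            Real.exp (-P.discount * τ) *
              inner ℝ p (P.unstraighten ε (y τ) - P.unstraighten ε (y 0)) ≤ τ * (c + κ)) := by
  obtain ⟨ρ, hρ, hest⟩ := exists_integrand_estimate hP i z p hκ
  refine ⟨ρ, hρ, fun ε hε τ hτ y a h hy c => ?_⟩
  have hi : ∀ r ∈ Icc 0 τ, y r ∈ halfPlane i := fun r hr => (hy r hr).1
  have hI1 : IntervalIntegrable
      (fun t => P.runningCost ε (y t) (a t) * Real.exp (-P.discount * t)) volume 0 τ :=
    (h.intervalIntegrable_runningCost hP hτ.1).mul_continuousOn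
      (by fun_prop : Continuous fun t => Real.exp (-P.discount * t)).continuousOn
  have hf := h.intervalIntegrable_f hP hτ.1 hi
  have hI2 : IntervalIntegrable (fun t => Real.exp (-P.discount * τ) *
      inner ℝ p (P.f i (P.unstraighten ε (y t)) (a t))) volume 0 τ := by
    rw [intervalIntegrable_iff] at hf ⊢
    exact (((innerSL ℝ p).integrable_comp hf).const_mul _)
  have hinner : (∫ t in (0 : ℝ)..τ, inner ℝ p (P.f i (P.unstraighten ε (y t)) (a t))) =
      inner ℝ p (P.unstraighten ε (y τ) - P.unstraighten ε (y 0)) := by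
    rw [h.unstraighten_sub_eq_integral hP hε hτ.1 hi]
    exact (innerSL ℝ p).intervalIntegral_comp_comm hf
  have hsum := intervalIntegral.integral_add hI1 hI2
  rw [intervalIntegral.integral_const_mul, hinner] at hsum
  rw [← hsum]
  have hae : ∀ᵐ t ∂(volume.restrict (Ioc 0 τ)),
      |(P.runningCost ε (y t) (a t) * Real.exp (-P.discount * t) +
        Real.exp (-P.discount * τ) * inner ℝ p (P.f i (P.unstraighten ε (y t)) (a t))) -
        (inner ℝ p (P.f i z (a t)) + P.cost i z (a t))| ≤ κ := by
    filter_upwards [h.ae_mem_ctrl hi, ae_restrict_mem measurableSet_Ioc] with t hat ht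
    have ht' := Ioc_subset_Icc_self ht
    rw [P.runningCost_of_mem_halfPlane ε (hi t ht')]
    exact hest t τ ⟨ht'.1, ht'.2.trans hτ.2⟩ hτ _ (hy t ht').2 _ hat
  have hconst : ∀ k : ℝ, τ * k = ∫ _ in (0 : ℝ)..τ, k := fun k => by simp
  rw [hconst, hconst]
  have hle : volume.restrict (Icc 0 τ) = volume.restrict (Ioc 0 τ) :=
    restrict_Ioc_eq_restrict_Icc.symm
  constructor
  · intro hc
    refine intervalIntegral.integral_mono_ae_restrict hτ.1 (by simp) (hI1.add hI2) ?_
    rw [hle]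
    filter_upwards [hae, hc] with t h1 h2
    linarith [(abs_le.1 h1).1]
  · intro hc
    refine intervalIntegral.integral_mono_ae_restrict hτ.1 (hI1.add hI2) (by simp) ?_
    rw [hle]
    filter_upwards [hae, hc] with t h1 h2
    linarith [(abs_le.1 h1).2]

end ControlProblem

theorem eventually_le_and_mul_le {ρ R : ℝ} (hρ : 0 < ρ) (hR : 0 < R) (K : ℝ) :
    ∀ᶠ τ in 𝓝[>] (0 : ℝ), τ ≤ ρ ∧ K * τ ≤ R := by
  have h1 : Tendsto (fun τ : ℝ => K * τ) (𝓝[>] 0) (𝓝 0) := by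
    have : Continuous fun τ : ℝ => K * τ := by fun_prop
    simpa using (this.tendsto 0).mono_left nhdsWithin_le_nhds
  filter_upwards [Ioo_mem_nhdsGT hρ, h1.eventually (gt_mem_nhds hR)] with τ h2 h3
  exact ⟨h2.2.le, h3.le⟩

namespace ControlProblem

variable {A : Type*} [MetricSpace A] {P : ControlProblem A}

/-- Moves the expansion to straightened coordinates. The price is an error proportional to `η` with
no factor `τ`, which is why `η` must tend to `0` before `τ`. -/
theorem exists_test_estimate (hP : P.StandingAssumptions)
    (i : Side) {z p : Plane} {φ : Plane → ℝ} (hφ : HasGradientAt φ p z)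
    (K : ℝ≥0) {κ : ℝ} (hκ : 0 < κ) :
    ∃ ρ > 0, ∀ ε τ η : ℝ, 0 < ε → 0 ≤ τ → τ ≤ ρ → 0 ≤ η → 2 * η + K * τ ≤ ρ →
      (∀ s, ε * |P.g s| ≤ η) → ∀ (y : ℝ → Plane) (a : ℝ → A), P.IsArc ε 0 τ y a →
      ‖y 0 - z‖ ≤ η → (∀ r ∈ Icc 0 τ, y r ∈ halfPlane i ∧ ‖y r - z‖ ≤ η + K * τ) → ∀ c : ℝ,
      ((∀ᵐ t ∂(volume.restrict (Ioc 0 τ)),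
          c ≤ inner ℝ p (P.f i z (a t)) + P.cost i z (a t)) →
        τ * (c - κ) - η * (3 * ‖p‖ + κ) ≤
          (∫ t in (0 : ℝ)..τ, P.runningCost ε (y t) (a t) * Real.exp (-P.discount * t)) +
            Real.exp (-P.discount * τ) * (φ (y τ) - φ z)) ∧
      ((∀ᵐ t ∂(volume.restrict (Ioc 0 τ)),
          inner ℝ p (P.f i z (a t)) + P.cost i z (a t) ≤ c) →
        (∫ t in (0 : ℝ)..τ, P.runningCost ε (y t) (a t) * Real.exp (-P.discount * t)) +
            Real.exp (-P.discount * τ) * (φ (y τ) - φ z) ≤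
          τ * (c + κ) + η * (3 * ‖p‖ + κ)) := by
  -- `κ'τ` is spent on the cost estimate and `κ'(η + Kτ)` on the first-order remainder of `φ`; the
  -- parts in `τ` add up to `κτ`.
  set κ' : ℝ := κ / (1 + K) with hκ'
  have hK1 : (0 : ℝ) < 1 + K := by positivity
  have hκ'0 : 0 < κ' := div_pos hκ hK1
  have hκK : κ' * (1 + K) = κ := div_mul_cancel₀ κ hK1.ne'
  have hκ'κ : κ' ≤ κ := by nlinarith [K.coe_nonneg]
  obtain ⟨ρ₁, hρ₁, hcost⟩ := exists_cost_estimate hP i z p hκ'0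
  have hlin : ∀ᶠ w in 𝓝 z, |φ w - φ z - inner ℝ p (w - z)| ≤ κ' * ‖w - z‖ := by
    have := Asymptotics.isLittleO_iff.1 (hasGradientAt_iff_isLittleO.1 hφ) hκ'0
    simpa only [Real.norm_eq_abs] using this
  obtain ⟨ρ₂, hρ₂, hlin⟩ := Metric.nhds_basis_closedBall.eventually_iff.1 hlin
  refine ⟨min ρ₁ ρ₂, lt_min hρ₁ hρ₂, ?_⟩
  intro ε τ η hε hτ hτρ hη hητ hg y a h hy0 hy c
  have hx : ∀ w, ‖P.unstraighten ε w - w‖ ≤ η := fun w => by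
    rw [norm_unstraighten_sub, abs_of_pos hε]
    exact hg _
  have hQ := hcost ε hε.ne' τ ⟨hτ, hτρ.trans (min_le_left _ _)⟩ y a h (fun r hr =>
    ⟨(hy r hr).1, by
      have h1 := norm_sub_le_norm_sub_add_norm_sub (P.unstraighten ε (y r)) (y r) z
      linarith [hx (y r), (hy r hr).2, min_le_left ρ₁ ρ₂]⟩) c
  have hyτ := (hy τ ⟨hτ, le_rfl⟩).2
  have h1 := hlin (Metric.mem_closedBall.2 (by
    rw [dist_eq_norm]
    linarith [min_le_right ρ₁ ρ₂] : dist (y τ) z ≤ ρ₂))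
  have h2 : |inner ℝ p (y τ - z) -
      inner ℝ p (P.unstraighten ε (y τ) - P.unstraighten ε (y 0))| ≤ ‖p‖ * (3 * η) := by
    rw [← inner_sub_right]
    refine (abs_real_inner_le_norm _ _).trans (mul_le_mul_of_nonneg_left ?_ (norm_nonneg _))
    -- Each of the three terms is at most `η`: the profile shift at time `τ`, the one at time `0`,
    -- and the offset of the starting point.
    have : y τ - z - (P.unstraighten ε (y τ) - P.unstraighten ε (y 0)) =
        -(P.unstraighten ε (y τ) - y τ) + (P.unstraighten ε (y 0) - y 0) + (y 0 - z) := by abel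
    rw [this]
    refine norm_add₃_le.trans ?_
    rw [norm_neg]
    linarith [hx (y τ), hx (y 0)]
  have h3 : |φ (y τ) - φ z - inner ℝ p (P.unstraighten ε (y τ) - P.unstraighten ε (y 0))| ≤
      ‖p‖ * (3 * η) + κ' * (η + K * τ) := by
    have := mul_le_mul_of_nonneg_left hyτ hκ'0.le
    rw [abs_le] at h1 h2 ⊢
    constructor <;> linarith
  have hexp : Real.exp (-P.discount * τ) ≤ 1 :=
    Real.exp_le_one_iff.2 (by nlinarith [hP.discount_pos])
  have h4 : |Real.exp (-P.discount * τ) * (φ (y τ) - φ z) - Real.exp (-P.discount * τ) *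
      inner ℝ p (P.unstraighten ε (y τ) - P.unstraighten ε (y 0))| ≤
      ‖p‖ * (3 * η) + κ' * (η + K * τ) := by
    rw [← mul_sub, abs_mul, Real.abs_exp]
    exact (mul_le_of_le_one_left (abs_nonneg _) hexp).trans h3
  have h5 : ‖p‖ * (3 * η) + κ' * (η + K * τ) ≤ τ * (κ - κ') + η * (3 * ‖p‖ + κ) := by
    have : κ - κ' = κ' * K := by linarith
    rw [this]
    nlinarith [mul_le_mul_of_nonneg_left hκ'κ hη]
  rw [abs_le] at h4
  constructor
  · intro hc
    have := hQ.1 hc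
    linarith
  · intro hc
    have := hQ.2 hc
    linarith

/-! ### The viscosity inequalities -/

theorem bddAbove_hamiltonian (hP : P.StandingAssumptions) (i : Side) (z p : Plane) :
    BddAbove ((fun a => -inner ℝ p (P.f i z a) - P.cost i z a) '' P.ctrl i) := by
  obtain ⟨M, hM⟩ := hP.f_bounded
  obtain ⟨N, hN⟩ := hP.cost_bounded
  refine ⟨‖p‖ * M + N, ?_⟩
  rintro _ ⟨a, ha, rfl⟩
  have h1 := (abs_le.1 ((abs_real_inner_le_norm p (P.f i z a)).trans
    (mul_le_mul_of_nonneg_left (hM i z a ha) (norm_nonneg p)))).1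
  have h2 := (abs_le.1 (hN i z a ha)).1
  linarith

theorem eventually_profile_le (hP : P.StandingAssumptions) {η : ℝ} (hη : 0 < η) :
    ∀ᶠ ε in 𝓝[>] (0 : ℝ), ∀ s, ε * |P.g s| ≤ η := by
  obtain ⟨B, hB0, hB⟩ := hP.exists_abs_g_le
  filter_upwards [Ioo_mem_nhdsGT (show (0 : ℝ) < η / (B + 1) by positivity)] with ε hε s
  have h1 : ε * (B + 1) ≤ η := (le_div_iff₀ (by positivity)).1 hε.2.le
  nlinarith [hB s, hε.1]

/-- The inequality is proved for one constant control at a time; the Hamiltonian appears on taking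
the supremum over `a`. -/
theorem upperSemilimit_mul_le (hP : P.StandingAssumptions)
    {i : Side} {φ : Plane → ℝ} (hφ : ContDiffOn ℝ 1 φ (halfPlane i))
    {z : Plane} (hz : z ∈ halfPlane i) (hmax : IsLocalMax (fun y => P.upperSemilimit y - φ y) z)
    {a : A} (ha : a ∈ P.ctrl i) :
    P.discount * P.upperSemilimit z ≤
      inner ℝ (gradient φ z) (P.f i z a) + P.cost i z a := by
  have hU := (isOpen_halfPlane i).mem_nhds hz
  have hgrad : HasGradientAt φ (gradient φ z) z :=
    ((hφ.contDiffAt hU).differentiableAt (by norm_num)).hasGradientAt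
  set p := gradient φ z with hp
  set W := P.upperSemilimit z with hW
  obtain ⟨C, hC⟩ := hP.exists_abs_value_le
  obtain ⟨K, hK⟩ := hP.exists_norm_sideDynamics_le
  refine mul_le_of_eventually_one_sub_exp fun κ hκ => ?_
  obtain ⟨ρ, hρ, hest⟩ := exists_test_estimate hP i hgrad K hκ
  obtain ⟨R, hR, hball⟩ := Metric.nhds_basis_closedBall.eventually_iff.1
    ((hmax : ∀ᶠ w in 𝓝 z, _).and hU)
  -- `Kτ` takes half of `min ρ R`, and `η` below takes at most a quarter. Then `2η + Kτ ≤ ρ`, and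
  -- the arc remains in the ball of radius `R`.
  filter_upwards [eventually_le_and_mul_le hρ (half_pos (lt_min hρ hR)) K,
    self_mem_nhdsWithin] with τ ⟨hτρ, hKτ⟩ (hτ : 0 < τ)
  have key : ∀ᶠ η in 𝓝[>] (0 : ℝ), W * (1 - Real.exp (-P.discount * τ)) ≤
      τ * (inner ℝ p (P.f i z a) + P.cost i z a + κ) + η * (2 + 3 * ‖p‖ + κ) := by
    filter_upwards [Ioo_mem_nhdsGT (show 0 < min ρ R / 4 from by positivity)] with η ⟨hη, hηR⟩
    have hev := eventually_forall_le_of_limsup_le hC (isCompact_closedBall z R)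
      (l := 𝓝[>] (0 : ℝ)) (ψ := fun w => W + (φ w - φ z))
      (fun w hw => ((hφ.continuousOn.continuousAt
        ((isOpen_halfPlane i).mem_nhds (hball hw).2)).sub_const _).const_add _)
      (fun w hw => by
        have := (hball hw).1
        change P.upperSemilimit w ≤ _
        linarith) hη
    -- Pairs `(ε, z')` nearly attaining the `limsup` occur arbitrarily close to `(0, z)`, so one of
    -- them also satisfies all the eventual conditions. The losses of `η` here and in `hev` give the
    -- `2` in `2 + 3‖p‖ + κ`.
    have hfreq : ∃ᶠ q in 𝓝[>] (0 : ℝ) ×ˢ 𝓝 z, W - η < P.value q.1 q.2 :=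
      frequently_lt_of_lt_limsup (isBoundedUnder_ge_of_abs_le hC _).isCoboundedUnder_le
        (show W - η < P.upperSemilimit z by linarith)
    have hev' : ∀ᶠ ε in 𝓝[>] (0 : ℝ), (0 < ε ∧ (∀ s, ε * |P.g s| ≤ η)) ∧
        (∀ z, (P.trajectories ε z).Nonempty) ∧
        ∀ w ∈ Metric.closedBall z R, P.value ε w ≤ W + (φ w - φ z) + η :=
      (eventually_mem_nhdsWithin.and (eventually_profile_le hP hη)).and
        ((eventually_trajectories_nonempty hP).and hev)
    have hηz : ∀ᶠ w in 𝓝 z, dist w z ≤ η := Metric.closedBall_mem_nhds z hη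
    obtain ⟨⟨ε, z'⟩, hlt, ⟨⟨hε, hg⟩, hne, hle⟩, hz'⟩ := (hfreq.and_eventually
      ((hev'.prod_inl (𝓝 z)).and (hηz.prod_inr _))).exists
    obtain ⟨y, hy0, hyl, harc⟩ := exists_flow hP hε.ne' ha (fun w => hK ε i w a ha) z'
    have hy0z : ‖y 0 - z‖ ≤ η := by
      rw [hy0, ← dist_eq_norm]
      exact hz'
    have hyz : ∀ r ∈ Icc 0 τ, ‖y r - z‖ ≤ η + K * τ := fun r hr => by
      have h1 := hyl.dist_le_mul r 0
      rw [dist_eq_norm, Real.dist_eq, sub_zero, abs_of_nonneg hr.1] at h1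
      have h2 := mul_le_mul_of_nonneg_left hr.2 K.coe_nonneg
      linarith [norm_sub_le_norm_sub_add_norm_sub (y r) (y 0) z]
    have hyR : ∀ r ∈ Icc 0 τ, y r ∈ Metric.closedBall z R := fun r hr => by
      rw [Metric.mem_closedBall, dist_eq_norm]
      linarith [hyz r hr, min_le_right ρ R]
    have h := harc τ hτ.le fun t ht => (hball (hyR t (Ioo_subset_Icc_self ht))).2
    have hD := (hest ε τ η hε hτ.le hτρ hη.le (by linarith [min_le_left ρ R]) hg y _ h hy0z
      (fun r hr => ⟨(hball (hyR r hr)).2, hyz r hr⟩) _).2 (ae_of_all _ fun _ => le_rfl)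
    have hdpp := value_le_add_value hP hτ.le h (hne _)
    have hend := mul_le_mul_of_nonneg_left (hle (y τ) (hyR τ ⟨hτ.le, le_rfl⟩))
      (Real.exp_nonneg (-P.discount * τ))
    have hexp : Real.exp (-P.discount * τ) ≤ 1 :=
      Real.exp_le_one_iff.2 (by nlinarith [hP.discount_pos])
    have hη' : Real.exp (-P.discount * τ) * η ≤ η := mul_le_of_le_one_left hη.le hexp
    rw [hy0] at hdpp
    simp only at hlt
    linarith
  have hcont : Continuous fun η : ℝ =>
      τ * (inner ℝ p (P.f i z a) + P.cost i z a + κ) + η * (2 + 3 * ‖p‖ + κ) := by fun_prop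
  have hlim := (hcont.tendsto 0).mono_left (nhdsWithin_le_nhds (s := Ioi 0))
  simp only [zero_mul, add_zero] at hlim
  exact ge_of_tendsto hlim key

/-- Along a nearly optimal trajectory the control is unknown, but almost every control value
satisfies `p·f + ℓ ≥ -H`, which is all the lower estimate requires. -/
theorem neg_hamiltonian_le (hP : P.StandingAssumptions)
    {i : Side} {φ : Plane → ℝ} (hφ : ContDiffOn ℝ 1 φ (halfPlane i))
    {z : Plane} (hz : z ∈ halfPlane i) (hmin : IsLocalMin (fun y => P.lowerSemilimit y - φ y) z) :
    -P.hamiltonian i z (gradient φ z) ≤ P.discount * P.lowerSemilimit z := by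
  have hU := (isOpen_halfPlane i).mem_nhds hz
  have hgrad : HasGradientAt φ (gradient φ z) z :=
    ((hφ.contDiffAt hU).differentiableAt (by norm_num)).hasGradientAt
  set p := gradient φ z with hp
  set W := P.lowerSemilimit z with hW
  set H := P.hamiltonian i z p with hH
  obtain ⟨C, hC⟩ := hP.exists_abs_value_le
  obtain ⟨K, hK⟩ := hP.exists_norm_dynamics_le
  -- The sign change allows the same small-time lemma to be used as for the subsolution.
  suffices P.discount * -W ≤ H by linarith
  refine mul_le_of_eventually_one_sub_exp fun κ hκ => ?_
  obtain ⟨ρ, hρ, hest⟩ := exists_test_estimate hP i hgrad K hκ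
  obtain ⟨R, hR, hball⟩ := Metric.nhds_basis_closedBall.eventually_iff.1
    ((hmin : ∀ᶠ w in 𝓝 z, _).and hU)
  filter_upwards [eventually_le_and_mul_le hρ (half_pos (lt_min hρ hR)) K,
    self_mem_nhdsWithin] with τ ⟨hτρ, hKτ⟩ (hτ : 0 < τ)
  have key : ∀ᶠ η in 𝓝[>] (0 : ℝ), -W * (1 - Real.exp (-P.discount * τ)) ≤
      τ * (H + κ) + η * (2 + 3 * ‖p‖ + κ) := by
    filter_upwards [Ioo_mem_nhdsGT (show 0 < min ρ R / 4 from by positivity)] with η ⟨hη, hηR⟩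
    have hev := eventually_forall_ge_of_le_liminf hC (isCompact_closedBall z R)
      (l := 𝓝[>] (0 : ℝ)) (ψ := fun w => W + (φ w - φ z))
      (fun w hw => ((hφ.continuousOn.continuousAt
        ((isOpen_halfPlane i).mem_nhds (hball hw).2)).sub_const _).const_add _)
      (fun w hw => by
        have := (hball hw).1
        change _ ≤ P.lowerSemilimit w
        linarith) hη
    have hfreq : ∃ᶠ q in 𝓝[>] (0 : ℝ) ×ˢ 𝓝 z, P.value q.1 q.2 < W + η :=
      frequently_lt_of_liminf_lt (isBoundedUnder_le_of_abs_le hC _).isCoboundedUnder_ge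
        (show P.lowerSemilimit z < W + η by linarith)
    have hev' : ∀ᶠ ε in 𝓝[>] (0 : ℝ), (0 < ε ∧ (∀ s, ε * |P.g s| ≤ η)) ∧
        (∀ z, (P.trajectories ε z).Nonempty) ∧
        ∀ w ∈ Metric.closedBall z R, W + (φ w - φ z) - η ≤ P.value ε w :=
      (eventually_mem_nhdsWithin.and (eventually_profile_le hP hη)).and
        ((eventually_trajectories_nonempty hP).and hev)
    have hηz : ∀ᶠ w in 𝓝 z, dist w z ≤ η := Metric.closedBall_mem_nhds z hη
    obtain ⟨⟨ε, z'⟩, hlt, ⟨⟨hε, hg⟩, hne, hge⟩, hz'⟩ := (hfreq.and_eventually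
      ((hev'.prod_inl (𝓝 z)).and (hηz.prod_inr _))).exists
    obtain ⟨_, ⟨⟨y, a⟩, hq, rfl⟩, hcost⟩ := exists_lt_of_csInf_lt
      ((hne z').image (P.totalCost ε)) hlt
    obtain ⟨hy0, harc⟩ := (mem_trajectories_iff hP).1 hq
    have h := harc τ hτ.le
    simp only at hy0 h
    have hy0z : ‖y 0 - z‖ ≤ η := by
      rw [hy0, ← dist_eq_norm]
      exact hz'
    have hyz : ∀ r ∈ Icc 0 τ, ‖y r - z‖ ≤ η + K * τ := fun r hr => by
      have h1 := h.norm_sub_le hP (hK ε) le_rfl hr.1 hr.2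
      rw [sub_zero] at h1
      have h2 := mul_le_mul_of_nonneg_left hr.2 K.coe_nonneg
      linarith [norm_sub_le_norm_sub_add_norm_sub (y r) (y 0) z]
    have hyR : ∀ r ∈ Icc 0 τ, y r ∈ Metric.closedBall z R := fun r hr => by
      rw [Metric.mem_closedBall, dist_eq_norm]
      linarith [hyz r hr, min_le_right ρ R]
    have hi : ∀ r ∈ Icc 0 τ, y r ∈ halfPlane i := fun r hr => (hball (hyR r hr)).2
    have hD := (hest ε τ η hε hτ.le hτρ hη.le (by linarith [min_le_left ρ R]) hg y a h hy0z
      (fun r hr => ⟨hi r hr, hyz r hr⟩) (-H)).1 (by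
        filter_upwards [h.ae_mem_ctrl hi] with t ht
        have := le_csSup (bddAbove_hamiltonian hP i z p) (mem_image_of_mem _ ht)
        change _ ≤ H at this
        linarith)
    have hdpp := add_value_le_totalCost hP hτ.le hq
    have hend := mul_le_mul_of_nonneg_left (hge (y τ) (hyR τ ⟨hτ.le, le_rfl⟩))
      (Real.exp_nonneg (-P.discount * τ))
    have hexp : Real.exp (-P.discount * τ) ≤ 1 :=
      Real.exp_le_one_iff.2 (by nlinarith [hP.discount_pos])
    have hη' : Real.exp (-P.discount * τ) * η ≤ η := mul_le_of_le_one_left hη.le hexp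
    simp only at hcost hdpp
    linarith
  have hcont : Continuous fun η : ℝ => τ * (H + κ) + η * (2 + 3 * ‖p‖ + κ) := by fun_prop
  have hlim := (hcont.tendsto 0).mono_left (nhdsWithin_le_nhds (s := Ioi 0))
  simp only [zero_mul, add_zero] at hlim
  exact ge_of_tendsto hlim key

theorem isViscositySubsolution_upperSemilimit (hP : P.StandingAssumptions) (i : Side) :
    IsViscositySubsolution P.discount (P.hamiltonian i) (halfPlane i) P.upperSemilimit := by
  obtain ⟨C, hC⟩ := hP.exists_abs_value_le
  refine ⟨(upperSemicontinuous_limsup hC (𝓝[>] 0)).upperSemicontinuousOn _,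
    fun φ hφ z hz hmax => ?_⟩
  have : P.hamiltonian i z (gradient φ z) ≤ -(P.discount * P.upperSemilimit z) := by
    refine csSup_le ((hP.ctrl_nonempty i).image _) ?_
    rintro _ ⟨a, ha, rfl⟩
    have := upperSemilimit_mul_le hP hφ hz hmax ha
    linarith
  linarith

theorem isViscositySupersolution_lowerSemilimit (hP : P.StandingAssumptions) (i : Side) :
    IsViscositySupersolution P.discount (P.hamiltonian i) (halfPlane i) P.lowerSemilimit := by
  obtain ⟨C, hC⟩ := hP.exists_abs_value_le
  refine ⟨(lowerSemicontinuous_liminf hC (𝓝[>] 0)).lowerSemicontinuousOn _,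
    fun φ hφ z hz hmin => ?_⟩
  have := neg_hamiltonian_le hP hφ hz hmin
  linarith

end ControlProblem

end OscillatingInterface

theorem mainTheorem9 {A : Type*} [MetricSpace A]
    (P : OscillatingInterface.ControlProblem A) (hP : P.StandingAssumptions) :
    (∃ C : ℝ, ∀ᶠ ε in 𝓝[>] (0 : ℝ), ∀ z,
      (P.trajectories ε z).Nonempty ∧ |P.value ε z| ≤ C) ∧
    (∃ C : ℝ, ∀ z, |P.upperSemilimit z| ≤ C ∧ |P.lowerSemilimit z| ≤ C) ∧
    ∀ i : OscillatingInterface.Side,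
      OscillatingInterface.IsViscositySubsolution P.discount (P.hamiltonian i)
        (OscillatingInterface.halfPlane i) P.upperSemilimit ∧
      OscillatingInterface.IsViscositySupersolution P.discount (P.hamiltonian i)
        (OscillatingInterface.halfPlane i) P.lowerSemilimit := by
  obtain ⟨C, hC⟩ := hP.exists_abs_value_le
  refine ⟨⟨C, ?_⟩, ⟨C, fun z => ⟨OscillatingInterface.abs_limsup_le hC _,
    OscillatingInterface.abs_liminf_le hC _⟩⟩, fun i =>
    ⟨OscillatingInterface.ControlProblem.isViscositySubsolution_upperSemilimit hP i,
      OscillatingInterface.ControlProblem.isViscositySupersolution_lowerSemilimit hP i⟩⟩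
  filter_upwards [OscillatingInterface.ControlProblem.eventually_trajectories_nonempty hP]
    with ε hε z
  exact ⟨hε z, hC ε z⟩
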